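/- **Setting.** For each $d\in\mathbb N=\{1,2,\dots\}$ let $D_d\subset\mathbb R^d$ be a Borel set of positive Lebesgue measure, $\rho_d$ a probability density on $D_d$, $G_d=L_2(D_d,\rho_d(x)\,dx)$, and $F_d$ a separable (real or complex) Hilbert space of functions on $D_d$, with the pointwise linear structure, such that $\mathrm{APP}_d:F_d\to G_d$, $\mathrm{APP}_df=f$, is well defined and compact. Function values need not be continuous functionals on $F_d$. Let $\Lambda^{\rm all}$ be the class of all linear functionals on $F_d$ (not necessarily continuous) and $\Lambda^{\rm std}$ the class of all function values $f\mapsto f(x)$, $x\in D_d$. For $\Lambda\in\{\Lambda^{\rm all},\Lambda^{\rm std}\}$, a randomized algorithm that uses $\Lambda$ is a family $$A^\omega(f)=\phi_{n,\omega}\big(L_{1,\omega}(f),\dots,L_{n,\omega}(f)\big),\qquad L_{j,\omega}\in\Lambda,\quad n=n(f,\omega)\in\{0,1,2,\dots\},$$ with $\omega$ from a probability space $(\Omega,\Sigma,\mathcal P)$ and measurable maps $\phi_{n,\omega}$ into $G_d$, where for each $\omega$ the decision to stop after $n(f,\omega)$ evaluations depends only on the values obtained so far, and where, for $f$ restricted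 to any finite-dimensional subspace of $F_d$, $A^\omega(f)$ and $n(f,\omega)$ are jointly measurable in $(f,\omega)$. Put $$\mathrm{Card}(A)=\sup_{\|f\|_{F_d}\le1}\mathbb E_\omega\, n(f,\omega),\qquad e^{\rm ran}(A)=\sup_{\|f\|_{F_d}\le1}\big(\mathbb E_\omega\|f-A^\omega(f)\|_{G_d}^2\big)^{1/2},$$ $$e^{\rm ran}(n,d;\Lambda)=\inf\{e^{\rm ran}(A):A\text{ uses }\Lambda,\ \mathrm{Card}(A)\le n\},$$ and let $n(\varepsilon,d;\Lambda)=\inf\{n\in\{0,1,2,\dots\}: e^{\rm ran}(n,d;\Lambda)\le\varepsilon\}$ be the information complexity in the randomized setting for the absolute error criterion. For the class $\Lambda$, the problem $\mathrm{APP}=\{\mathrm{APP}_d\}_{d\in\mathbb N}$ is called * **ALG-SPT** if there are $C>0$, $p\ge0$ with $n(\varepsilon,d;\Lambda)\le C\varepsilon^{-p}$ for all $d\in\mathbb N$, $\varepsilon\in(0,1)$; the infimum of such $p$ is the exponent of ALG-SPT; * **ALG-PT** if there are $C>0$, $p,q\ge0$ with $n(\varepsilon,d;\Lambda)\le Cd^{q}\varepsilon^{-p}$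 for all $d\in\mathbb N$, $\varepsilon\in(0,1)$; * **ALG-QPT** if there are $C>0$, $t\ge0$ with $n(\varepsilon,d;\Lambda)\le C\exp\big(t(1+\ln d)(1+\ln\varepsilon^{-1})\big)$ for all $d\in\mathbb N$, $\varepsilon\in(0,1)$; the infimum of such $t$ is the exponent of ALG-QPT; * **ALG-WT** if all $n(\varepsilon,d;\Lambda)$ with $d\in\mathbb N$, $\varepsilon\in(0,1)$ are finite and $\displaystyle\lim_{\varepsilon^{-1}+d\to\infty}\frac{\ln n(\varepsilon,d;\Lambda)}{\varepsilon^{-1}+d}=0$, where $\ln0:=0$. (An exponent is $\infty$ if the corresponding notion does not hold.) **Theorem 2.5.** For every such problem $\mathrm{APP}$, with no condition on the initial errors $e^{\rm ran}(0,d;\Lambda)$: 1. each of ALG-SPT, ALG-PT, ALG-QPT, ALG-WT holds for $\Lambda^{\rm all}$ if and only if the same notion holds for $\Lambda^{\rm std}$; 2. the exponent of ALG-SPT for $\Lambda^{\rm all}$ equals that for $\Lambda^{\rm std}$, and the exponent of ALG-QPT for $\Lambda^{\rm all}$ equals that for $\Lambda^{\rm std}$. -/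

import Mathlib

open MeasureTheory Filter Topology Set
open scoped ENNReal NNReal

noncomputable section

/-- The data of one `d`-variate approximation problem: a separable Hilbert space `F` of functions
on a Borel set `D ⊆ ℝ^d` of positive Lebesgue measure and a probability density `ρ` on `D`, such
that `F` embeds compactly into the weighted space `L₂(D, ρ(x) dx)`. The scalars are real or
complex. Point evaluations need not be continuous on `F`. -/
structure ApproxProblem (𝕜 : Type) [RCLike 𝕜] (d : ℕ) where
  /-- the domain of the functions -/
  D : Set (Fin d → ℝ)
  measurableSet_D : MeasurableSet D
  volume_D_pos : 0 < volume D
  /-- the weight -/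
  ρ : D → ℝ
  measurable_ρ : Measurable ρ
  ρ_nonneg : ∀ x, 0 ≤ ρ x
  lintegral_ρ : ∫⁻ x, ENNReal.ofReal (ρ x) ∂(volume.comap ((↑) : D → Fin d → ℝ)) = 1
  /-- the Hilbert space -/
  F : Type
  [normedAddCommGroup : NormedAddCommGroup F]
  [innerProductSpace : InnerProductSpace 𝕜 F]
  [completeSpace : CompleteSpace F]
  [separableSpace : TopologicalSpace.SeparableSpace F]
  /-- the elements of `F` are functions on `D`, with the pointwise linear structure -/
  eval : F →ₗ[𝕜] (D → 𝕜)
  eval_injective : Function.Injective eval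
  memLp : ∀ f : F, MemLp (eval f) 2
    ((volume.comap ((↑) : D → Fin d → ℝ)).withDensity fun x => ENNReal.ofReal (ρ x))
  isCompact : IsCompactOperator fun f : F => (memLp f).toLp (eval f)

attribute [instance] ApproxProblem.normedAddCommGroup ApproxProblem.innerProductSpace
  ApproxProblem.completeSpace ApproxProblem.separableSpace

namespace ApproxProblem

variable {𝕜 : Type} [RCLike 𝕜] {d : ℕ}

/-- The probability measure `ρ(x) dx` on `D`. -/
def weight (S : ApproxProblem 𝕜 d) : Measure S.D :=
  (volume.comap ((↑) : S.D → Fin d → ℝ)).withDensity fun x => ENNReal.ofReal (S.ρ x)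

/-- The target space `G = L₂(D, ρ(x) dx)`. -/
abbrev G (S : ApproxProblem 𝕜 d) : Type := Lp 𝕜 2 S.weight

/-- The embedding operator `APP f = f` from `F` into `G`. -/
def app (S : ApproxProblem 𝕜 d) (f : S.F) : S.G := (S.memLp f).toLp (S.eval f)

/-- The class `Λ^all` of all linear functionals on `F`, continuous or not. -/
def allInfo (S : ApproxProblem 𝕜 d) : Set (S.F →ₗ[𝕜] 𝕜) := Set.univ

/-- The class `Λ^std` of all function values `f ↦ f(x)`, `x ∈ D`. -/
def stdInfo (S : ApproxProblem 𝕜 d) : Set (S.F →ₗ[𝕜] 𝕜) :=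
  {L | ∃ x : S.D, ∀ f : S.F, L f = S.eval f x}

/-- A randomized algorithm
`A^ω(f) = φ_{n,ω}(L_{1,ω}(f), …, L_{n,ω}(f))`, `n = n(f, ω)`, with information functionals from
the class `Λ`. The functionals and the maps `φ` are selected at random according to a probability
space; the number `n(f, ω)` of evaluations may be random and adaptive. -/
structure RandAlg (S : ApproxProblem 𝕜 d) (Λ : Set (S.F →ₗ[𝕜] 𝕜)) where
  Ω : Type
  [measurableSpace : MeasurableSpace Ω]
  P : Measure Ω
  [isProbabilityMeasure : IsProbabilityMeasure P]
  /-- the functionals `L_{1,ω}, L_{2,ω}, …` (indexed from `0`) -/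
  L : Ω → ℕ → (S.F →ₗ[𝕜] 𝕜)
  L_mem : ∀ ω j, L ω j ∈ Λ
  /-- the number `n(f, ω)` of functionals that are evaluated -/
  card : S.F → Ω → ℕ
  /-- the decision to stop after `n(f, ω)` evaluations is based on the values obtained so far:
  an input with the same values is treated in the same way -/
  card_adaptive : ∀ (ω : Ω) (f g : S.F),
    (∀ j < card f ω, L ω j f = L ω j g) → card g ω = card f ω
  /-- the maps `φ_{n,ω} : 𝕜^n → G` -/
  φ : Ω → (n : ℕ) → (Fin n → 𝕜) → S.G
  measurable_φ : ∀ ω n, StronglyMeasurable (φ ω n)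
  /-- `n(f, ω)` is jointly measurable in `f` and `ω` when `f` runs through a finite-dimensional
  space `span {v₁, …, v_k}` -/
  measurable_card : ∀ (k : ℕ) (v : Fin k → S.F),
    Measurable fun q : (Fin k → 𝕜) × Ω => card (∑ i, q.1 i • v i) q.2
  /-- `A^ω(f)` is jointly measurable in `f` and `ω` when `f` runs through a finite-dimensional
  space `span {v₁, …, v_k}` -/
  measurable_out : ∀ (k : ℕ) (v : Fin k → S.F),
    StronglyMeasurable fun q : (Fin k → 𝕜) × Ω =>
      φ q.2 (card (∑ i, q.1 i • v i) q.2) fun j => L q.2 j (∑ i, q.1 i • v i)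

attribute [instance] RandAlg.measurableSpace RandAlg.isProbabilityMeasure

namespace RandAlg

variable {S : ApproxProblem 𝕜 d} {Λ : Set (S.F →ₗ[𝕜] 𝕜)}

/-- The output `A^ω(f)`. -/
def out (A : RandAlg S Λ) (f : S.F) (ω : A.Ω) : S.G :=
  A.φ ω (A.card f ω) fun j => A.L ω j f

/-- The cardinality `sup_{‖f‖ ≤ 1} E n(f, ω)`. -/
def cardinality (A : RandAlg S Λ) : ℝ≥0∞ :=
  ⨆ (f : S.F) (_ : ‖f‖ ≤ 1), ∫⁻ ω, (A.card f ω : ℝ≥0∞) ∂A.P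

/-- The randomized error `sup_{‖f‖ ≤ 1} (E ‖APP f - A^ω(f)‖²)^{1/2}`. -/
def error (A : RandAlg S Λ) : ℝ≥0∞ :=
  ⨆ (f : S.F) (_ : ‖f‖ ≤ 1), (∫⁻ ω, ‖S.app f - A.out f ω‖ₑ ^ 2 ∂A.P) ^ (1 / 2 : ℝ)

end RandAlg

/-- The `n`th minimal randomized error `e^ran(n; Λ)`. -/
def minError (S : ApproxProblem 𝕜 d) (Λ : Set (S.F →ₗ[𝕜] 𝕜)) (n : ℕ) : ℝ≥0∞ :=
  ⨅ (A : RandAlg S Λ) (_ : A.cardinality ≤ n), A.error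

/-- The information complexity `n^{ran,ABS}(ε; Λ) = inf {n | e^ran(n; Λ) ≤ ε}` for the absolute
error criterion (`⊤` if there is no such `n`). -/
def infoComplexity (S : ApproxProblem 𝕜 d) (Λ : Set (S.F →ₗ[𝕜] 𝕜)) (ε : ℝ) : ℕ∞ :=
  ⨅ (n : ℕ) (_ : S.minError Λ n ≤ ENNReal.ofReal ε), (n : ℕ∞)

end ApproxProblem

/-! Notions of algebraic tractability of an information complexity `N d ε = n(ε, d)`. -/

/-- `n(ε, d) ≤ C ε^{-p}` for some `C > 0`, all `d` and all `ε ∈ (0,1)`. -/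
def AlgSPTWith (N : ℕ+ → ℝ → ℕ∞) (p : ℝ≥0) : Prop :=
  ∃ C : ℝ, 0 < C ∧ ∀ (d : ℕ+) (ε : ℝ), ε ∈ Ioo (0 : ℝ) 1 →
    (N d ε : ℝ≥0∞) ≤ ENNReal.ofReal (C * ε ^ (-(p : ℝ)))

/-- Algebraic strong polynomial tractability. -/
def AlgSPT (N : ℕ+ → ℝ → ℕ∞) : Prop := ∃ p : ℝ≥0, AlgSPTWith N p

/-- The exponent of algebraic strong polynomial tractability (`⊤` if that does not hold). -/
def algSPTExponent (N : ℕ+ → ℝ → ℕ∞) : ℝ≥0∞ := ⨅ (p : ℝ≥0) (_ : AlgSPTWith N p), (p : ℝ≥0∞)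

/-- Algebraic polynomial tractability. -/
def AlgPT (N : ℕ+ → ℝ → ℕ∞) : Prop :=
  ∃ C : ℝ, 0 < C ∧ ∃ p q : ℝ≥0, ∀ (d : ℕ+) (ε : ℝ), ε ∈ Ioo (0 : ℝ) 1 →
    (N d ε : ℝ≥0∞) ≤ ENNReal.ofReal (C * ((d : ℕ) : ℝ) ^ (q : ℝ) * ε ^ (-(p : ℝ)))

/-- `n(ε, d) ≤ C exp(t (1 + ln d) (1 + ln ε⁻¹))` for some `C > 0`, all `d` and all
`ε ∈ (0,1)`. -/
def AlgQPTWith (N : ℕ+ → ℝ → ℕ∞) (t : ℝ≥0) : Prop :=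
  ∃ C : ℝ, 0 < C ∧ ∀ (d : ℕ+) (ε : ℝ), ε ∈ Ioo (0 : ℝ) 1 →
    (N d ε : ℝ≥0∞) ≤ ENNReal.ofReal
      (C * Real.exp (t * (1 + Real.log ((d : ℕ) : ℝ)) * (1 + Real.log ε⁻¹)))

/-- Algebraic quasi-polynomial tractability. -/
def AlgQPT (N : ℕ+ → ℝ → ℕ∞) : Prop := ∃ t : ℝ≥0, AlgQPTWith N t

/-- The exponent of algebraic quasi-polynomial tractability (`⊤` if that does not hold). -/
def algQPTExponent (N : ℕ+ → ℝ → ℕ∞) : ℝ≥0∞ := ⨅ (t : ℝ≥0) (_ : AlgQPTWith N t), (t : ℝ≥0∞)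

/-- Algebraic weak tractability: `n(ε, d)` is finite and `ln n(ε, d) / (ε⁻¹ + d) → 0` as
`ε⁻¹ + d → ∞`, where `ε ∈ (0,1)` and `ln 0 = 0`. -/
def AlgWT (N : ℕ+ → ℝ → ℕ∞) : Prop :=
  (∀ (d : ℕ+) (ε : ℝ), ε ∈ Ioo (0 : ℝ) 1 → N d ε ≠ ⊤) ∧
  Tendsto (fun z : ℝ × ℕ+ => Real.log ((N z.2 z.1).toNat : ℝ) / (z.1⁻¹ + ((z.2 : ℕ) : ℝ)))
    (comap (fun z : ℝ × ℕ+ => z.1⁻¹ + ((z.2 : ℕ) : ℝ)) atTop ⊓ 𝓟 {z | z.1 ∈ Ioo (0 : ℝ) 1})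
    (𝓝 0)

end

/-! Function values are linear functionals, so only the passage from arbitrary functionals to
function values needs an argument. It rests on `exists_infoComplexity_stdInfo_le`: for `η ∈ (0,1]`,
the complexity for function values at `ε` is at most `C n^(1+η)`, where `n` is the complexity for
all functionals at `ε/(1+η)` and `C` depends on `η` alone. Each tractability notion survives this
change of `ε` and `n`, and `η → 0` gives equality of the exponents.

Lower bound (`le_error_sq`). Suppose the embedding is bounded below by `σ` on an `m`-dimensional
subspace. For fixed randomness, an algorithm that reads `K` functionals cannot tell a point of the
sphere from its reflection in the span of their representers. Averaging over the sphere costs a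
fraction `K/m` of `σ²`, and Markov's inequality controls the runs that read more than `K` values.
Hence an error `ε` reached with `n` functionals leaves only `O(n)` singular values noticeably above
`ε`, and the embedding is nearly an orthogonal projection of rank `N = O(n)`.

Upper bound (`exists_hasVariance`). The `N` coefficients are estimated by interpolation at a
determinantal point process, with mean square error at most `N` times the squared distance to the
span. Stochastic gradient steps at points drawn from the Christoffel density then reduce the factor
`N` to a small constant after `O(N log N)` further samples. The logarithm is absorbed into the power
`1+η`. -/

noncomputable section

/-! ### Singular vectors of compact operators. -/

section SingularVectors

variable {𝕜 F G : Type*} [RCLike 𝕜] [NormedAddCommGroup F] [InnerProductSpace 𝕜 F]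
  [CompleteSpace F] [NormedAddCommGroup G] [InnerProductSpace 𝕜 G]

/-- A compact symmetric operator whose eigenvalues are all bounded by `c` has norm at most `c`. -/
theorem opNorm_le_of_forall_hasEigenvalue {A : F →L[𝕜] F} (hA : IsCompactOperator A)
    (hA' : A.IsSymmetric) {c : ℝ} (hc : 0 ≤ c)
    (h : ∀ μ : 𝕜, Module.End.HasEigenvalue (A : Module.End 𝕜 F) μ → ‖μ‖ ≤ c) : ‖A‖ ≤ c := by
  have h1 := A.spectralRadius_eq_nnnorm hA'.isSelfAdjoint
  have h2 : spectralRadius 𝕜 A ≤ ENNReal.ofReal c := by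
    refine iSup₂_le fun μ hμ => ?_
    rw [← enorm_eq_nnnorm, ← ofReal_norm]
    refine ENNReal.ofReal_le_ofReal ?_
    -- Zero may lie in the spectrum without being an eigenvalue; every other spectral value of a
    -- compact operator is one.
    by_cases h0 : μ = 0
    · simpa [h0] using hc
    · exact h μ ((hA.hasEigenvalue_iff_mem_spectrum h0).2 hμ)
  rw [h1, ← enorm_eq_nnnorm, ← ofReal_norm] at h2
  exact (ENNReal.ofReal_le_ofReal_iff hc).1 h2

/-- Orthonormal families of right singular vectors of `T` whose singular values are at least
`σ`. -/
def IsSingularFamily [CompleteSpace G] (T : F →L[𝕜] G) (σ : ℝ) {n : ℕ} (v : Fin n → F)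
    (l : Fin n → ℝ) : Prop :=
  Orthonormal 𝕜 v ∧ ∀ i, σ ^ 2 ≤ l i ∧ T.adjoint (T (v i)) = (l i : 𝕜) • v i

variable [CompleteSpace G] {T : F →L[𝕜] G} {σ : ℝ} {n : ℕ} {v : Fin n → F} {l : Fin n → ℝ}

theorem IsSingularFamily.inner_apply (h : IsSingularFamily T σ v l) (i : Fin n) (f : F) :
    inner 𝕜 (T (v i)) (T f) = (l i : 𝕜) * inner 𝕜 (v i) f := by
  rw [← ContinuousLinearMap.adjoint_inner_left, (h.2 i).2, inner_smul_left]
  simp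

/-- The vectors `T (v i)` are pairwise orthogonal with squared lengths `l i`, so the right-hand side
equals `∑ l i ‖x i‖²`. -/
theorem IsSingularFamily.le_norm_sq (h : IsSingularFamily T σ v l) (x : Fin n → 𝕜) :
    σ ^ 2 * ∑ i, ‖x i‖ ^ 2 ≤ ‖T (∑ i, x i • v i)‖ ^ 2 := by
  have h1 : inner 𝕜 (T (∑ i, x i • v i)) (T (∑ i, x i • v i))
      = ((∑ i, l i * ‖x i‖ ^ 2 : ℝ) : 𝕜) := by
    conv_lhs => rw [map_sum T (fun i => x i • v i), sum_inner]
    push_cast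
    refine Finset.sum_congr rfl fun i _ => ?_
    rw [map_smul, inner_smul_left, ← map_sum, h.inner_apply, h.1.inner_right_fintype,
      mul_left_comm, RCLike.conj_mul]
  rw [inner_self_eq_norm_sq_to_K] at h1
  have h2 : ‖T (∑ i, x i • v i)‖ ^ 2 = ∑ i, l i * ‖x i‖ ^ 2 := by exact_mod_cast h1
  rw [h2, Finset.mul_sum]
  exact Finset.sum_le_sum fun i _ => mul_le_mul_of_nonneg_right (h.2 i).1 (by positivity)

/-- A singular family either extends or captures the operator up to an error `σ`. -/
theorem IsSingularFamily.exists_extension (hT : IsCompactOperator T)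
    (h : IsSingularFamily T σ v l) :
    (∃ v' l', IsSingularFamily (n := n + 1) T σ v' l') ∨
      ∀ f, (∀ i, inner 𝕜 (v i) f = 0) → ‖T f‖ ^ 2 ≤ σ ^ 2 * ‖f‖ ^ 2 := by
  let A : F →L[𝕜] F := T.adjoint ∘L T
  have hAc : IsCompactOperator A := hT.clm_comp T.adjoint
  have hAs : A.IsSymmetric := fun x y => by
    change inner 𝕜 (T.adjoint (T x)) y = inner 𝕜 x (T.adjoint (T y))
    rw [ContinuousLinearMap.adjoint_inner_left, ContinuousLinearMap.adjoint_inner_right]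
  -- The complement of a span of eigenvectors of `T*T` is invariant under `T*T`. The eigenvalues of
  -- the restriction `B` decide between the two alternatives.
  let W : Submodule 𝕜 F := (Submodule.span 𝕜 (Set.range v))ᗮ
  have hW : ∀ f, f ∈ W ↔ ∀ i, inner 𝕜 (v i) f = 0 := by
    intro f
    rw [Submodule.mem_orthogonal]
    refine ⟨fun hf i => hf _ (Submodule.subset_span ⟨i, rfl⟩), fun hf u hu => ?_⟩
    induction hu using Submodule.span_induction with
    | mem x hx => obtain ⟨i, rfl⟩ := hx; exact hf i
    | zero => simp
    | add x y _ _ hx hy => rw [inner_add_left, hx, hy, add_zero]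
    | smul a x _ hx => rw [inner_smul_left, hx, mul_zero]
  have hinv : ∀ f ∈ W, A f ∈ W := by
    intro f hf
    rw [hW] at hf ⊢
    intro i
    change inner 𝕜 (v i) (T.adjoint (T f)) = 0
    rw [ContinuousLinearMap.adjoint_inner_right, h.inner_apply, hf i, mul_zero]
  let B : W →L[𝕜] W := A.restrict hinv
  have hBc : IsCompactOperator B := hAc.restrict' hinv
  have hBs : B.IsSymmetric := hAs.restrict_invariant hinv
  by_cases hB : ∀ μ : 𝕜, Module.End.HasEigenvalue (B : Module.End 𝕜 W) μ → ‖μ‖ ≤ σ ^ 2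
  · right
    have hn := opNorm_le_of_forall_hasEigenvalue hBc hBs (sq_nonneg σ) hB
    intro f hf
    let f' : W := ⟨f, (hW f).2 hf⟩
    have h1 : ‖T f‖ ^ 2 = RCLike.re (inner 𝕜 (B f') f') := by
      rw [← inner_self_eq_norm_sq (𝕜 := 𝕜), ← ContinuousLinearMap.adjoint_inner_left]
      rfl
    calc ‖T f‖ ^ 2 ≤ ‖B f'‖ * ‖f'‖ := h1 ▸ re_inner_le_norm _ _
      _ ≤ (σ ^ 2 * ‖f'‖) * ‖f'‖ := by gcongr; exact B.le_of_opNorm_le hn f'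
      _ = σ ^ 2 * ‖f‖ ^ 2 := by rw [show ‖f'‖ = ‖f‖ from rfl]; ring
  · left
    push Not at hB
    obtain ⟨μ, hμ, hμσ⟩ := hB
    obtain ⟨w, hw, hw0⟩ := hμ.exists_hasEigenvector
    rw [Module.End.mem_genEigenspace_one] at hw
    have hw' : T.adjoint (T (w : F)) = μ • (w : F) := congrArg Subtype.val hw
    have hwF : (w : F) ≠ 0 := fun h0 => hw0 (Subtype.ext h0)
    have hwn : (‖(w : F)‖ : 𝕜) ≠ 0 := by simpa using hwF
    -- The eigenvalue is a Rayleigh quotient, hence real and nonnegative.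
    have hμr : μ = ((‖T (w : F)‖ ^ 2 / ‖(w : F)‖ ^ 2 : ℝ) : 𝕜) := by
      have h3 : inner 𝕜 (w : F) (T.adjoint (T (w : F))) = μ * (‖(w : F)‖ : 𝕜) ^ 2 := by
        rw [hw', inner_smul_right, inner_self_eq_norm_sq_to_K]
      rw [ContinuousLinearMap.adjoint_inner_right, inner_self_eq_norm_sq_to_K] at h3
      push_cast
      rw [eq_div_iff (pow_ne_zero 2 hwn), h3]
    set r : ℝ := ‖T (w : F)‖ ^ 2 / ‖(w : F)‖ ^ 2 with hr
    have hr0 : 0 ≤ r := by positivity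
    have hrσ : σ ^ 2 ≤ r := by
      rw [hμr, RCLike.norm_ofReal, abs_of_nonneg hr0] at hμσ
      exact hμσ.le
    have hwW := (hW _).1 w.2
    refine ⟨Fin.snoc v ((‖(w : F)‖ : 𝕜)⁻¹ • (w : F)), Fin.snoc l r, ?_, ?_⟩
    · rw [orthonormal_iff_ite]
      have hv := orthonormal_iff_ite.1 h.1
      intro i j
      induction i using Fin.lastCases with
      | last =>
        induction j using Fin.lastCases with
        | last =>
          simp only [Fin.snoc_last, if_true]
          rw [inner_smul_left, inner_smul_right, inner_self_eq_norm_sq_to_K]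
          simp only [map_inv₀, RCLike.conj_ofReal]
          field_simp
        | cast j =>
          rw [if_neg (Fin.castSucc_lt_last j).ne']
          simp only [Fin.snoc_last, Fin.snoc_castSucc]
          rw [inner_smul_left, inner_eq_zero_symm.1 (hwW j), mul_zero]
      | cast i =>
        induction j using Fin.lastCases with
        | last =>
          rw [if_neg (Fin.castSucc_lt_last i).ne]
          simp only [Fin.snoc_last, Fin.snoc_castSucc]
          rw [inner_smul_right, hwW i, mul_zero]
        | cast j => simpa using hv i j
    · intro i
      induction i using Fin.lastCases with
      | last =>
        simp only [Fin.snoc_last]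
        refine ⟨hrσ, ?_⟩
        rw [map_smul, map_smul, hw', hμr, smul_comm]
      | cast i => simpa using h.2 i

/-- If `‖T f‖ ≥ σ ‖f‖` on no `m`-dimensional subspace, then `T` is approximated up to an error `σ`
by the orthogonal projection onto the image of fewer than `m` vectors. -/
theorem exists_orthonormal_approximation (hT : IsCompactOperator T) (hσ : 0 < σ) {m : ℕ}
    (hm : ∀ v : Fin m → F, Orthonormal 𝕜 v →
      ¬ ∀ x : Fin m → 𝕜, σ ^ 2 * ∑ i, ‖x i‖ ^ 2 ≤ ‖T (∑ i, x i • v i)‖ ^ 2) :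
    ∃ N < m, ∃ w : Fin N → F, Orthonormal 𝕜 (fun i => T (w i)) ∧
      ∀ f, ‖T f - ∑ i, inner 𝕜 (T (w i)) (T f) • T (w i)‖ ^ 2 ≤ σ ^ 2 * ‖f‖ ^ 2 := by
  classical
  -- Singular families of length `m` are excluded by `hm`. Just before the first impossible length
  -- there is a family without extension, so it captures `T` up to `σ`.
  let Q : ℕ → Prop := fun n => ∃ (v : Fin n → F) (l : Fin n → ℝ), IsSingularFamily T σ v l
  have hQm : ¬ Q m := fun ⟨v, l, h⟩ => hm v h.1 h.le_norm_sq
  have hex : ∃ n, ¬ Q n := ⟨m, hQm⟩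
  have hQ0 : Q 0 := ⟨Fin.elim0, Fin.elim0, ⟨⟨fun i => i.elim0, fun i => i.elim0⟩,
    fun i => i.elim0⟩⟩
  have hfind0 : Nat.find hex ≠ 0 := fun h0 => Nat.find_spec hex (h0 ▸ hQ0)
  obtain ⟨N, hN⟩ := Nat.exists_eq_succ_of_ne_zero hfind0
  have hNQ : Q N := not_not.1 (Nat.find_min hex (by omega))
  have hNm : N < m := by
    have := Nat.find_min' hex hQm
    omega
  obtain ⟨v, l, h⟩ := hNQ
  have hrest := (h.exists_extension hT).resolve_left
    (by rintro ⟨v', l', h'⟩; exact Nat.find_spec hex (by rw [hN]; exact ⟨v', l', h'⟩))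
  have hl : ∀ i, 0 < l i := fun i => lt_of_lt_of_le (by positivity) (h.2 i).1
  have hs : ∀ i, ((√(l i) : ℝ) : 𝕜) * ((√(l i) : ℝ) : 𝕜) = (l i : 𝕜) := fun i => by
    rw [← RCLike.ofReal_mul, Real.mul_self_sqrt (hl i).le]
  have hs0 : ∀ i, ((√(l i) : ℝ) : 𝕜) ≠ 0 := fun i => by
    simpa using (Real.sqrt_pos.2 (hl i)).ne'
  -- Since `‖T (v i)‖² = l i`, this scaling makes the images orthonormal. Projecting `T f` onto them
  -- is the same as applying `T` to the projection of `f` onto the `v i`.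
  refine ⟨N, hNm, fun i => ((√(l i) : ℝ) : 𝕜)⁻¹ • v i, ?_, fun f => ?_⟩
  · rw [orthonormal_iff_ite]
    intro i j
    simp only [map_smul]
    rw [inner_smul_left, inner_smul_right, h.inner_apply, orthonormal_iff_ite.1 h.1 i j]
    by_cases hij : i = j
    · subst hij
      simp only [if_true, map_inv₀, RCLike.conj_ofReal, ← hs]
      field_simp [hs0 i]
    · simp [hij]
  · have hproj : ∑ i, inner 𝕜 (T (((√(l i) : ℝ) : 𝕜)⁻¹ • v i)) (T f) •
        T (((√(l i) : ℝ) : 𝕜)⁻¹ • v i) = T (∑ i, inner 𝕜 (v i) f • v i) := by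
      rw [map_sum]
      refine Finset.sum_congr rfl fun i _ => ?_
      rw [map_smul, map_smul, inner_smul_left, h.inner_apply, smul_smul, ← hs]
      congr 1
      simp only [map_inv₀, RCLike.conj_ofReal]
      field_simp [hs0 i]
    rw [hproj, ← map_sub]
    set g := f - ∑ i, inner 𝕜 (v i) f • v i with hg
    have hgo : ∀ i, inner 𝕜 (v i) g = 0 := fun i => by
      rw [hg, inner_sub_right, h.1.inner_right_fintype, sub_self]
    refine (hrest g hgo).trans ?_
    have hgf : ‖g‖ ^ 2 ≤ ‖f‖ ^ 2 := by
      have h5 : inner 𝕜 g (∑ i, inner 𝕜 (v i) f • v i) = 0 := by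
        rw [inner_sum]
        refine Finset.sum_eq_zero fun i _ => ?_
        rw [inner_smul_right, inner_eq_zero_symm.1 (hgo i), mul_zero]
      have h6 : f = g + ∑ i, inner 𝕜 (v i) f • v i := by rw [hg]; abel
      have h7 := norm_add_sq_eq_norm_sq_add_norm_sq_of_inner_eq_zero _ _ h5
      rw [← h6] at h7
      nlinarith [mul_self_nonneg ‖∑ i, inner 𝕜 (v i) f • v i‖]
    gcongr

end SingularVectors

/-! ### The uniform distribution on the unit sphere. -/

section UniformSphere

variable {𝕜 : Type} [RCLike 𝕜]

/-- The image is again a Haar measure, hence a multiple of `μ`; an isometry preserves the unit ball,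
so the factor is `1`. -/
theorem map_linearIsometryEquiv_addHaar {m : ℕ} (μ : Measure (EuclideanSpace 𝕜 (Fin m)))
    [μ.IsAddHaarMeasure] (e : EuclideanSpace 𝕜 (Fin m) ≃ₗᵢ[𝕜] EuclideanSpace 𝕜 (Fin m)) :
    μ.map e = μ := by
  have hh : (μ.map e).IsAddHaarMeasure :=
    e.toLinearEquiv.toAddEquiv.isAddHaarMeasure_map μ e.continuous e.symm.continuous
  have h1 := Measure.isAddLeftInvariant_eq_smul (μ.map e) μ
  set c := (μ.map e).addHaarScalarFactor μ
  have h2 : (μ.map e) (Metric.ball 0 1) = μ (Metric.ball 0 1) := by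
    rw [Measure.map_apply e.continuous.measurable measurableSet_ball]
    congr 1
    ext x
    simp
  have hpos : 0 < μ (Metric.ball (0 : EuclideanSpace 𝕜 (Fin m)) 1) :=
    Metric.measure_ball_pos μ 0 one_pos
  have hfin : μ (Metric.ball (0 : EuclideanSpace 𝕜 (Fin m)) 1) < ∞ := measure_ball_lt_top
  rw [h1] at h2 ⊢
  have h3 : (c : ℝ≥0∞) * μ (Metric.ball 0 1) = 1 * μ (Metric.ball 0 1) := by
    rw [one_mul]; exact h2
  have h4 : (c : ℝ≥0∞) = 1 := (ENNReal.mul_left_inj hpos.ne' hfin.ne).1 h3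
  have h5 : c = 1 := by exact_mod_cast h4
  rw [h5, one_smul]

/-- A rotation invariant probability measure on the unit sphere of `𝕜^m`. -/
theorem exists_uniform_sphere (𝕜 : Type) [RCLike 𝕜] {m : ℕ} (hm : 0 < m) :
    ∃ ν : Measure (EuclideanSpace 𝕜 (Fin m)), IsProbabilityMeasure ν ∧ (∀ᵐ x ∂ν, ‖x‖ = 1) ∧
      ∀ e : EuclideanSpace 𝕜 (Fin m) ≃ₗᵢ[𝕜] EuclideanSpace 𝕜 (Fin m),
        MeasurePreserving e ν ν := by
  have : NeZero m := ⟨hm.ne'⟩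
  let μ : Measure (EuclideanSpace 𝕜 (Fin m)) := Measure.addHaar
  -- The sphere measure is the radial projection of the uniform distribution on the ball. Projection
  -- and ball both commute with isometries.
  let κ := ProbabilityTheory.cond μ (Metric.ball 0 1)
  have hpos : μ (Metric.ball 0 1) ≠ 0 := (Metric.measure_ball_pos μ 0 one_pos).ne'
  have hfin : μ (Metric.ball 0 1) ≠ ∞ := measure_ball_lt_top.ne
  have hκ : IsProbabilityMeasure κ := ProbabilityTheory.cond_isProbabilityMeasure_of_finite hpos hfin
  let p : EuclideanSpace 𝕜 (Fin m) → EuclideanSpace 𝕜 (Fin m) := fun x => ((‖x‖⁻¹ : ℝ) : 𝕜) • x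
  have hp : Measurable p := by
    have h : Measurable fun x : EuclideanSpace 𝕜 (Fin m) => ((‖x‖⁻¹ : ℝ) : 𝕜) :=
      RCLike.measurable_ofReal.comp measurable_norm.inv
    exact h.smul measurable_id
  refine ⟨κ.map p, Measure.isProbabilityMeasure_map hp.aemeasurable, ?_, fun e => ?_⟩
  · rw [ae_map_iff hp.aemeasurable (measurableSet_eq_fun measurable_norm measurable_const)]
    have h0 : ∀ᵐ x ∂μ, x ≠ 0 := by
      rw [ae_iff]
      rw [show {a : EuclideanSpace 𝕜 (Fin m) | ¬ a ≠ 0} = {0} by ext; simp]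
      have hnt : Nontrivial (EuclideanSpace 𝕜 (Fin m)) :=
        Module.nontrivial_of_finrank_pos (R := 𝕜) (by simpa using hm)
      have : (𝓝[≠] (0 : EuclideanSpace 𝕜 (Fin m))).NeBot := Module.punctured_nhds_neBot 𝕜 _ 0
      exact measure_singleton 0
    have h1 : ∀ᵐ x ∂κ, x ≠ 0 :=
      ProbabilityTheory.cond_absolutelyContinuous.ae_le h0
    filter_upwards [h1] with x hx
    simp [p, norm_smul, norm_ne_zero_iff.2 hx]
  · have he : Measurable e := e.continuous.measurable
    refine ⟨he, ?_⟩
    have h1 : κ.map e = κ := by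
      simp only [κ, ProbabilityTheory.cond, Measure.map_smul]
      congr 1
      conv_rhs => rw [← map_linearIsometryEquiv_addHaar μ e]
      rw [Measure.restrict_map he measurableSet_ball]
      congr 2
      ext x
      simp
    have h2 : e ∘ p = p ∘ e := by
      ext1 x
      simp [p]
    rw [Measure.map_map he hp, h2, ← Measure.map_map hp he, h1]

/-- Rotation invariance determines the second moments. -/
theorem lintegral_inner_sq {m : ℕ} (hm : 0 < m) {ν : Measure (EuclideanSpace 𝕜 (Fin m))}
    [IsProbabilityMeasure ν] (hν : ∀ᵐ x ∂ν, ‖x‖ = 1)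
    (hinv : ∀ e : EuclideanSpace 𝕜 (Fin m) ≃ₗᵢ[𝕜] EuclideanSpace 𝕜 (Fin m),
      MeasurePreserving e ν ν) {w : EuclideanSpace 𝕜 (Fin m)} (hw : ‖w‖ = 1) :
    ∫⁻ x, ‖inner 𝕜 w x‖ₑ ^ 2 ∂ν = (m : ℝ≥0∞)⁻¹ := by
  obtain ⟨b, hb⟩ := Orthonormal.exists_orthonormalBasis_extension_of_card_eq (𝕜 := 𝕜)
    (E := EuclideanSpace 𝕜 (Fin m)) (ι := Fin m) (by simp) (v := fun _ => w)
    (s := {⟨0, hm⟩}) (by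
      rw [orthonormal_subsingleton_iff]
      intro i
      simpa using hw)
  have hb0 : b ⟨0, hm⟩ = w := hb _ rfl
  have hmeas : ∀ v : EuclideanSpace 𝕜 (Fin m), Measurable fun x => ‖inner 𝕜 v x‖ₑ ^ 2 := fun v =>
    ((continuous_const.inner continuous_id).measurable.enorm.pow_const 2)
  have hall : ∀ i, ∫⁻ x, ‖inner 𝕜 (b i) x‖ₑ ^ 2 ∂ν = ∫⁻ x, ‖inner 𝕜 w x‖ₑ ^ 2 ∂ν := by
    intro i
    -- Permuting the basis is an isometry, so all coordinates have the same second moment; these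
    -- moments sum to `1` by Parseval.
    let e := b.equiv b (Equiv.swap ⟨0, hm⟩ i)
    rw [← (hinv e).lintegral_comp (hmeas (b i))]
    refine lintegral_congr fun x => ?_
    have h1 : e (b ⟨0, hm⟩) = b i := by
      simp [e]
    rw [← h1, LinearIsometryEquiv.inner_map_map, hb0]
  have hsum : ∑ i, ∫⁻ x, ‖inner 𝕜 (b i) x‖ₑ ^ 2 ∂ν = 1 := by
    rw [← lintegral_finsetSum _ fun i _ => hmeas (b i)]
    have h2 : ∀ᵐ x ∂ν, ∑ i, ‖inner 𝕜 (b i) x‖ₑ ^ 2 = 1 := by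
      filter_upwards [hν] with x hx
      have h3 := b.sum_sq_norm_inner_right x
      rw [hx] at h3
      have : ∀ i, ‖inner 𝕜 (b i) x‖ₑ ^ 2 = ENNReal.ofReal (‖inner 𝕜 (b i) x‖ ^ 2) := fun i => by
        rw [ENNReal.ofReal_pow (norm_nonneg _), ofReal_norm]
      simp_rw [this]
      rw [← ENNReal.ofReal_sum_of_nonneg fun i _ => by positivity, h3]
      simp
    rw [lintegral_congr_ae h2]
    simp
  simp only [hall, Finset.sum_const, Finset.card_univ, Fintype.card_fin, nsmul_eq_mul] at hsum
  exact ENNReal.eq_inv_of_mul_eq_one_left (by rwa [mul_comm])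

/-- On average, a subspace carries the fraction `dim U / m` of the squared length. This is the share
of a random input that is visible through few functionals. -/
theorem lintegral_starProjection_sq {m : ℕ} (hm : 0 < m)
    {ν : Measure (EuclideanSpace 𝕜 (Fin m))}
    [IsProbabilityMeasure ν] (hν : ∀ᵐ x ∂ν, ‖x‖ = 1)
    (hinv : ∀ e : EuclideanSpace 𝕜 (Fin m) ≃ₗᵢ[𝕜] EuclideanSpace 𝕜 (Fin m),
      MeasurePreserving e ν ν) (U : Submodule 𝕜 (EuclideanSpace 𝕜 (Fin m))) :
    ∫⁻ x, ‖U.starProjection x‖ₑ ^ 2 ∂ν = Module.finrank 𝕜 U * (m : ℝ≥0∞)⁻¹ := by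
  let b := stdOrthonormalBasis 𝕜 U
  have h1 : ∀ x, ‖U.starProjection x‖ₑ ^ 2 = ∑ i, ‖inner 𝕜 (b i : EuclideanSpace 𝕜 (Fin m)) x‖ₑ ^ 2 := by
    intro x
    have h2 := b.sum_sq_norm_inner_right (U.orthogonalProjectionOnto x)
    have h3 : ∀ i, inner 𝕜 (b i) (U.orthogonalProjectionOnto x)
        = inner 𝕜 (b i : EuclideanSpace 𝕜 (Fin m)) x := fun i => by
      simp
    simp_rw [h3] at h2
    have : ∀ y : 𝕜, ‖y‖ₑ ^ 2 = ENNReal.ofReal (‖y‖ ^ 2) := fun y => by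
      rw [ENNReal.ofReal_pow (norm_nonneg _), ofReal_norm]
    simp_rw [this]
    rw [← ENNReal.ofReal_sum_of_nonneg fun i _ => by positivity, h2,
      ENNReal.ofReal_pow (norm_nonneg _), ofReal_norm]
    rfl
  simp_rw [h1]
  rw [lintegral_finsetSum _ fun i _ => Measurable.pow_const
    (Continuous.measurable (by fun_prop) :
      Measurable fun x => inner 𝕜 (b i : EuclideanSpace 𝕜 (Fin m)) x).enorm 2]
  have h4 : ∀ i, ∫⁻ x, ‖inner 𝕜 (b i : EuclideanSpace 𝕜 (Fin m)) x‖ₑ ^ 2 ∂ν = (m : ℝ≥0∞)⁻¹ :=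
    fun i => lintegral_inner_sq hm hν hinv (b.orthonormal.1 i)
  simp [h4]

end UniformSphere

namespace ApproxProblem

variable {𝕜 : Type} [RCLike 𝕜] {d : ℕ} (S : ApproxProblem 𝕜 d)

/-- The embedding as a continuous linear operator. -/
def appL : S.F →L[𝕜] S.G :=
  ContinuousLinearMap.mkOfIsCompactOperator (f :=
    { toFun := S.app
      map_add' := fun f g => by
        simp only [app, map_add]
        exact MemLp.toLp_add (S.memLp f) (S.memLp g)
      map_smul' := fun c f => by
        simp only [app, map_smul]
        exact MemLp.toLp_const_smul c (S.memLp f) : S.F →ₗ[𝕜] S.G }) S.isCompact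

theorem isCompactOperator_appL : IsCompactOperator S.appL := S.isCompact

end ApproxProblem

/-! ### The lower bound for randomized algorithms. -/

section Averaging

variable {𝕜 G : Type*} [RCLike 𝕜] [NormedAddCommGroup G] [InnerProductSpace 𝕜 G]

/-- A single output `c` for two indistinguishable inputs `a` and `b` is bad for at least one of
them. -/
theorem half_norm_sub_sq_le (a b c : G) : ‖a - b‖ ^ 2 ≤ 2 * (‖a - c‖ ^ 2 + ‖b - c‖ ^ 2) := by
  have h : ‖a - b‖ ≤ ‖a - c‖ + ‖b - c‖ := by
    have := norm_sub_le (a - c) (b - c)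
    simpa using this
  nlinarith [norm_nonneg (a - b), sq_nonneg (‖a - c‖ - ‖b - c‖)]

end Averaging

namespace ApproxProblem.RandAlg

variable {𝕜 : Type} [RCLike 𝕜] {d : ℕ} {S : ApproxProblem 𝕜 d} {Λ : Set (S.F →ₗ[𝕜] 𝕜)}

theorem lintegral_card_le (A : RandAlg S Λ) {f : S.F} (hf : ‖f‖ ≤ 1) :
    ∫⁻ ω, (A.card f ω : ℝ≥0∞) ∂A.P ≤ A.cardinality :=
  le_iSup₂ (f := fun (f : S.F) (_ : ‖f‖ ≤ 1) => ∫⁻ ω, (A.card f ω : ℝ≥0∞) ∂A.P) f hf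

theorem lintegral_error_le (A : RandAlg S Λ) {f : S.F} (hf : ‖f‖ ≤ 1) :
    ∫⁻ ω, ‖S.app f - A.out f ω‖ₑ ^ 2 ∂A.P ≤ A.error ^ 2 := by
  have h := le_iSup₂ (f := fun (f : S.F) (_ : ‖f‖ ≤ 1) =>
    (∫⁻ ω, ‖S.app f - A.out f ω‖ₑ ^ 2 ∂A.P) ^ (1 / 2 : ℝ)) f hf
  calc _ = ((∫⁻ ω, ‖S.app f - A.out f ω‖ₑ ^ 2 ∂A.P) ^ (1 / 2 : ℝ)) ^ 2 := by
        rw [← ENNReal.rpow_natCast, ← ENNReal.rpow_mul]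
        norm_num
    _ ≤ A.error ^ 2 := pow_le_pow_left' h 2

theorem card_congr (A : RandAlg S Λ) {ω : A.Ω} {K : ℕ} {f g : S.F} (hK : A.card f ω ≤ K)
    (h : ∀ j < K, A.L ω j f = A.L ω j g) : A.card g ω = A.card f ω :=
  A.card_adaptive ω f g fun j hj => h j (hj.trans_le hK)

theorem out_congr (A : RandAlg S Λ) {ω : A.Ω} {K : ℕ} {f g : S.F} (hK : A.card f ω ≤ K)
    (h : ∀ j < K, A.L ω j f = A.L ω j g) : A.out g ω = A.out f ω := by
  have hc := A.card_congr hK h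
  unfold out
  rw [hc]
  congr 1
  ext j
  exact (h j (j.2.trans_le hK)).symm

/-- For fixed randomness the average error over a sphere is bounded from below: the algorithm
cannot distinguish a vector from its reflection at the span of the information functionals. -/
theorem le_lintegral_sphere (A : RandAlg S Λ) (K : ℕ) {m : ℕ} (hm : 0 < m) (v : Fin m → S.F)
    {σ : ℝ} (hσ : ∀ x : Fin m → 𝕜, σ ^ 2 * ∑ i, ‖x i‖ ^ 2 ≤ ‖S.app (∑ i, x i • v i)‖ ^ 2)
    {ν : Measure (EuclideanSpace 𝕜 (Fin m))} [IsProbabilityMeasure ν] (hν : ∀ᵐ x ∂ν, ‖x‖ = 1)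
    (hinv : ∀ e : EuclideanSpace 𝕜 (Fin m) ≃ₗᵢ[𝕜] EuclideanSpace 𝕜 (Fin m),
      MeasurePreserving e ν ν) (ω : A.Ω)
    (hcard : Measurable fun x : EuclideanSpace 𝕜 (Fin m) => A.card (∑ i, x i • v i) ω)
    (hout : StronglyMeasurable fun x : EuclideanSpace 𝕜 (Fin m) => A.out (∑ i, x i • v i) ω) :
    ENNReal.ofReal (σ ^ 2) ≤
      ∫⁻ x, ‖S.app (∑ i, x i • v i) - A.out (∑ i, x i • v i) ω‖ₑ ^ 2 ∂ν +
        ENNReal.ofReal (σ ^ 2) *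
          (K * (m : ℝ≥0∞)⁻¹ + ν {x | K + 1 ≤ A.card (∑ i, x i • v i) ω}) := by
  let f : EuclideanSpace 𝕜 (Fin m) →ₗ[𝕜] S.F :=
    { toFun := fun x => ∑ i, x i • v i
      map_add' := fun x y => by simp [add_smul, Finset.sum_add_distrib]
      map_smul' := fun c x => by simp [Finset.smul_sum, smul_smul] }
  have hf : ∀ x : EuclideanSpace 𝕜 (Fin m), ∑ i, x i • v i = f x := fun x => rfl
  simp only [hf] at hcard hout ⊢
  have hfσ : ∀ x : EuclideanSpace 𝕜 (Fin m), σ ^ 2 * ‖x‖ ^ 2 ≤ ‖S.app (f x)‖ ^ 2 := fun x => by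
    rw [EuclideanSpace.norm_sq_eq]
    exact hσ x
  have hfc : Continuous f := f.continuous_of_finiteDimensional
  -- Riesz representers of the first `K` functionals. On the finite-dimensional space even a
  -- discontinuous functional on `F` becomes continuous.
  let a : Fin K → EuclideanSpace 𝕜 (Fin m) := fun j =>
    (InnerProductSpace.toDual 𝕜 _).symm (LinearMap.toContinuousLinearMap (A.L ω j ∘ₗ f))
  have ha : ∀ j x, inner 𝕜 (a j) x = A.L ω j (f x) := fun j x => by simp [a]
  let U := Submodule.span 𝕜 (Set.range a)
  -- The reflection fixes all representers, so `x` and `R x` yield the same `K` values.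
  let R := U.reflection
  have hRL : ∀ x, ∀ j < K, A.L ω j (f x) = A.L ω j (f (R x)) := by
    intro x j hj
    have h1 : R (a ⟨j, hj⟩) = a ⟨j, hj⟩ :=
      Submodule.reflection_mem_subspace_eq_self (Submodule.subset_span ⟨_, rfl⟩)
    have h2 := ha ⟨j, hj⟩ x
    have h3 := ha ⟨j, hj⟩ (R x)
    rw [← h1, LinearIsometryEquiv.inner_map_map] at h3
    rw [← h2, ← h3]
  have hRR : ∀ x, R (R x) = x := fun x => U.reflection_reflection x
  -- The inputs on which at most `K` functionals are read. Stopping depends only on the observed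
  -- values, so `B` is invariant under `R`.
  let B : Set (EuclideanSpace 𝕜 (Fin m)) := {x | A.card (f x) ω ≤ K}
  have hB : MeasurableSet B := measurableSet_le hcard measurable_const
  have hBR : ∀ x, x ∈ B → R x ∈ B := fun x hx => by
    change A.card (f (R x)) ω ≤ K
    rw [A.card_congr hx (hRL x)]
    exact hx
  have hBR' : ∀ x, R x ∈ B ↔ x ∈ B := fun x =>
    ⟨fun h => by simpa only [hRR] using hBR _ h, hBR x⟩
  let g : EuclideanSpace 𝕜 (Fin m) → ℝ≥0∞ := fun x => ‖S.app (f x) - A.out (f x) ω‖ₑ ^ 2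
  have hg : Measurable g := by
    have h1 : StronglyMeasurable fun x => S.app (f x) :=
      (S.appL.continuous.comp hfc).stronglyMeasurable
    exact ((h1.sub hout).enorm).pow_const 2
  have hgB : Measurable (B.indicator g) := hg.indicator hB
  -- On `B` both inputs receive the same output and `x - R x` is twice the part of `x` orthogonal to
  -- `U`, of squared length `1 - ‖P x‖²`. Off `B` the indicator term alone suffices.
  have hpt : ∀ x, ‖x‖ = 1 → 2 * ENNReal.ofReal (σ ^ 2) ≤
      2 * ENNReal.ofReal (σ ^ 2) * (‖U.starProjection x‖ₑ ^ 2 + Bᶜ.indicator 1 x) +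
        (B.indicator g x + B.indicator g (R x)) := by
    intro x hx
    by_cases hxB : x ∈ B
    · have hRxB := (hBR' x).2 hxB
      rw [indicator_of_mem hxB, indicator_of_mem hRxB, indicator_of_notMem (by simpa using hxB),
        add_zero]
      have h1 : A.out (f (R x)) ω = A.out (f x) ω := A.out_congr hxB (hRL x)
      have e1 : ∀ {E : Type} [NormedAddCommGroup E] (y : E), ‖y‖ₑ ^ 2 = ENNReal.ofReal (‖y‖ ^ 2) :=
        fun y => by rw [ENNReal.ofReal_pow (norm_nonneg _), ofReal_norm]
      simp only [g, h1, e1]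
      rw [← ENNReal.ofReal_add (by positivity) (by positivity),
        show 2 * ENNReal.ofReal (σ ^ 2) = ENNReal.ofReal (2 * σ ^ 2) by
          rw [ENNReal.ofReal_mul zero_le_two, ENNReal.ofReal_ofNat],
        ← ENNReal.ofReal_mul (by positivity), ← ENNReal.ofReal_add (by positivity) (by positivity)]
      refine ENNReal.ofReal_le_ofReal ?_
      have h2 := half_norm_sub_sq_le (S.app (f x)) (S.app (f (R x))) (A.out (f x) ω)
      have h3 : S.app (f x) - S.app (f (R x)) = (2 : 𝕜) • S.app (f (x - U.starProjection x)) := by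
        have h4 : x - R x = (2 : 𝕜) • (x - U.starProjection x) := by
          rw [show R x = 2 • U.starProjection x - x from U.reflection_apply x, smul_sub,
            two_smul 𝕜, two_smul 𝕜, two_nsmul]
          abel
        have h5 : S.appL (f x) - S.appL (f (R x)) = (2 : 𝕜) • S.appL (f (x - U.starProjection x)) := by
          rw [← map_sub, ← map_sub, h4, map_smul, map_smul]
        exact h5
      rw [h3, norm_smul, mul_pow] at h2
      have h6 := hfσ (x - U.starProjection x)
      have h7 : ‖x - U.starProjection x‖ ^ 2 = 1 - ‖U.starProjection x‖ ^ 2 := by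
        have h8 := norm_add_sq_eq_norm_sq_add_norm_sq_of_inner_eq_zero (𝕜 := 𝕜) _ _
          (U.starProjection_inner_eq_zero x _ (U.starProjection_apply_mem x))
        rw [sub_add_cancel, hx] at h8
        linarith
      rw [h7] at h6
      have h9 : ‖(2 : 𝕜)‖ = 2 := by simp
      rw [h9] at h2
      nlinarith
    · rw [indicator_of_mem (show x ∈ Bᶜ from hxB), Pi.one_apply]
      refine le_trans ?_ le_self_add
      conv_lhs => rw [← mul_one (2 * ENNReal.ofReal (σ ^ 2))]
      gcongr
      exact le_add_self
  have hgR : Measurable fun x => B.indicator g (R x) := hgB.comp R.continuous.measurable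
  have hgs : Measurable fun x => B.indicator g x + B.indicator g (R x) := hgB.add hgR
  have hint := lintegral_mono_ae (hν.mono hpt)
  rw [lintegral_const, measure_univ, mul_one,
    lintegral_add_right _ hgs,
    lintegral_const_mul' _ _ (by finiteness), lintegral_add_right _ (measurable_one.indicator hB.compl),
    lintegral_indicator_one hB.compl, lintegral_add_left hgB, (hinv R).lintegral_comp hgB,
    lintegral_starProjection_sq hm hν hinv, ← two_mul, mul_assoc, ← mul_add,
    ENNReal.mul_le_mul_iff_right two_ne_zero (by simp), add_comm] at hint
  refine hint.trans (add_le_add ?_ ?_)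
  · exact lintegral_mono fun x => indicator_le_self _ _ x
  · have hU : Module.finrank 𝕜 U ≤ K := by
      have := finrank_range_le_card (R := 𝕜) a
      simpa [Set.finrank, U] using this
    have hBc : Bᶜ = {x | K + 1 ≤ A.card (f x) ω} := by
      ext x
      simp [B]
    rw [hBc]
    gcongr

/-- The randomized error of an algorithm of cardinality `n` on a problem that is bounded from below
by `σ` on an `m`-dimensional subspace. -/
theorem le_error_sq (A : RandAlg S Λ) {n : ℕ} (hn : A.cardinality ≤ n) (K : ℕ) {m : ℕ} (hm : 0 < m)
    {v : Fin m → S.F} (hv : Orthonormal 𝕜 v) {σ : ℝ}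
    (hσ : ∀ x : Fin m → 𝕜, σ ^ 2 * ∑ i, ‖x i‖ ^ 2 ≤ ‖S.app (∑ i, x i • v i)‖ ^ 2) :
    ENNReal.ofReal (σ ^ 2) ≤ A.error ^ 2 +
      ENNReal.ofReal (σ ^ 2) * (K * (m : ℝ≥0∞)⁻¹ + n / ((K + 1 : ℕ) : ℝ≥0∞)) := by
  obtain ⟨ν, hνp, hν, hinv⟩ := exists_uniform_sphere 𝕜 hm
  let f : EuclideanSpace 𝕜 (Fin m) → S.F := fun x => ∑ i, x i • v i
  have hf1 : ∀ x, ‖x‖ = 1 → ‖f x‖ ≤ 1 := by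
    intro x hx
    have h1 : ‖f x‖ ^ 2 = ‖x‖ ^ 2 := by
      rw [EuclideanSpace.norm_sq_eq, ← inner_self_eq_norm_sq (𝕜 := 𝕜), hv.inner_sum, map_sum]
      refine Finset.sum_congr rfl fun i _ => ?_
      rw [RCLike.conj_mul]
      norm_cast
    rw [hx] at h1
    nlinarith [norm_nonneg (f x)]
  have hfc : Continuous f := by fun_prop
  let h0 : EuclideanSpace 𝕜 (Fin m) × A.Ω → (Fin m → 𝕜) × A.Ω := fun q => (fun i => q.1 i, q.2)
  have hh0 : Measurable h0 := by
    refine Measurable.prodMk ?_ measurable_snd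
    exact (Continuous.measurable (by fun_prop :
      Continuous fun x : EuclideanSpace 𝕜 (Fin m) => fun i => x i)).comp measurable_fst
  have hcard : Measurable fun q : EuclideanSpace 𝕜 (Fin m) × A.Ω => A.card (f q.1) q.2 :=
    (A.measurable_card m v).comp hh0
  have hout : StronglyMeasurable fun q : EuclideanSpace 𝕜 (Fin m) × A.Ω => A.out (f q.1) q.2 :=
    (A.measurable_out m v).comp_measurable hh0
  have hg : Measurable fun q : EuclideanSpace 𝕜 (Fin m) × A.Ω =>
      ‖S.app (f q.1) - A.out (f q.1) q.2‖ₑ ^ 2 := by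
    have h1 : StronglyMeasurable fun x => S.app (f x) :=
      (S.appL.continuous.comp hfc).stronglyMeasurable
    exact (((h1.comp_measurable measurable_fst).sub hout).enorm).pow_const 2
  have hcard' : Measurable fun q : EuclideanSpace 𝕜 (Fin m) × A.Ω =>
      (A.card (f q.1) q.2 : ℝ≥0∞) := (measurable_of_countable _).comp hcard
  have hω : ∀ ω, ENNReal.ofReal (σ ^ 2) ≤ ∫⁻ x, ‖S.app (f x) - A.out (f x) ω‖ₑ ^ 2 ∂ν +
      ENNReal.ofReal (σ ^ 2) * (K * (m : ℝ≥0∞)⁻¹ +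
        (∫⁻ x, (A.card (f x) ω : ℝ≥0∞) ∂ν) / ((K + 1 : ℕ) : ℝ≥0∞)) := by
    intro ω
    have hc : Measurable fun x => A.card (f x) ω := hcard.comp measurable_prodMk_right
    refine (A.le_lintegral_sphere K hm v hσ hν hinv ω hc
      (hout.comp_measurable measurable_prodMk_right)).trans ?_
    gcongr
    -- Markov's inequality for the number of evaluations.
    have h1 := meas_ge_le_lintegral_div (μ := ν) (f := fun x => (A.card (f x) ω : ℝ≥0∞))
      (hcard'.comp measurable_prodMk_right).aemeasurable
      (ε := ((K + 1 : ℕ) : ℝ≥0∞)) (by simp) (by finiteness)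
    simpa only [Nat.cast_le] using h1
  have hint := lintegral_mono (μ := A.P) hω
  rw [lintegral_const, measure_univ, mul_one] at hint
  rw [lintegral_add_left (by exact hg.lintegral_prod_left'), lintegral_const_mul' _ _ (by finiteness),
    lintegral_add_left measurable_const, lintegral_const, measure_univ, mul_one] at hint
  simp only [div_eq_mul_inv] at hint ⊢
  rw [lintegral_mul_const' _ _ (by simp)] at hint
  refine hint.trans ?_
  -- Exchanging the integrals lets the worst-case bounds on error and cardinality apply at each
  -- input separately.
  have hsw : ∀ {h : EuclideanSpace 𝕜 (Fin m) → A.Ω → ℝ≥0∞} {c : ℝ≥0∞},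
      Measurable (fun q : EuclideanSpace 𝕜 (Fin m) × A.Ω => h q.1 q.2) →
      (∀ x, ‖x‖ = 1 → ∫⁻ ω, h x ω ∂A.P ≤ c) → ∫⁻ ω, ∫⁻ x, h x ω ∂ν ∂A.P ≤ c := by
    intro h c hh hc
    rw [← lintegral_lintegral_swap (by exact hh.aemeasurable)]
    refine (lintegral_mono_ae (hν.mono hc)).trans ?_
    simp
  gcongr
  · exact hsw hg fun x hx => A.lintegral_error_le (hf1 x hx)
  · exact hsw hcard' fun x hx => (A.lintegral_card_le (hf1 x hx)).trans hn

end ApproxProblem.RandAlg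

/-! ### Orthonormal functions, the Christoffel density and the Andréief identity. -/

section SquareIntegrable

variable {𝕜 X : Type} [RCLike 𝕜] [MeasurableSpace X] {μ : Measure X}

/-- The semi-inner product of two scalar functions. -/
def l2Inner (μ : Measure X) (f g : X → 𝕜) : 𝕜 := ∫ x, (starRingEnd 𝕜) (f x) * g x ∂μ

theorem MeasureTheory.MemLp.integrable_conj_mul {f g : X → 𝕜} (hf : MemLp f 2 μ) (hg : MemLp g 2 μ) :
    Integrable (fun x => (starRingEnd 𝕜) (f x) * g x) μ :=
  MemLp.integrable_mul hf.star hg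

theorem l2Inner_self {f : X → 𝕜} : l2Inner μ f f = ((∫ x, ‖f x‖ ^ 2 ∂μ : ℝ) : 𝕜) := by
  rw [l2Inner, ← integral_ofReal]
  congr 1
  ext x
  rw [RCLike.conj_mul]
  norm_cast

theorem l2Inner_add_right {f g h : X → 𝕜} (hf : MemLp f 2 μ) (hg : MemLp g 2 μ)
    (hh : MemLp h 2 μ) : l2Inner μ f (fun x => g x + h x) = l2Inner μ f g + l2Inner μ f h := by
  simp only [l2Inner, mul_add]
  exact integral_add (hf.integrable_conj_mul hg) (hf.integrable_conj_mul hh)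

theorem l2Inner_sum_right {ι : Type*} {s : Finset ι} {f : X → 𝕜} {u : ι → X → 𝕜} (c : ι → 𝕜)
    (hf : MemLp f 2 μ) (hu : ∀ i, MemLp (u i) 2 μ) :
    l2Inner μ f (fun x => ∑ i ∈ s, c i * u i x) = ∑ i ∈ s, c i * l2Inner μ f (u i) := by
  simp only [l2Inner, Finset.mul_sum, ← integral_const_mul]
  rw [integral_finsetSum _ fun i _ => ?_]
  · refine Finset.sum_congr rfl fun i _ => integral_congr_ae (ae_of_all _ fun x => ?_)
    simp only
    ring
  · have := (hf.integrable_conj_mul (hu i)).const_mul (c i)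
    refine this.congr (ae_of_all _ fun x => ?_)
    simp only
    ring

theorem conj_l2Inner (f g : X → 𝕜) : (starRingEnd 𝕜) (l2Inner μ f g) = l2Inner μ g f := by
  rw [l2Inner, l2Inner, ← integral_conj]
  congr 1
  ext x
  simp [mul_comm]

/-- An orthonormal family of honest measurable functions in `L²`. -/
structure IsL2Orthonormal (μ : Measure X) {N : ℕ} (u : Fin N → X → 𝕜) : Prop where
  measurable : ∀ i, Measurable (u i)
  memLp : ∀ i, MemLp (u i) 2 μ
  inner_eq : ∀ i j, l2Inner μ (u i) (u j) = if i = j then 1 else 0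

namespace IsL2Orthonormal

variable {N : ℕ} {u : Fin N → X → 𝕜}

theorem memLp_sum (h : IsL2Orthonormal μ u) (c : Fin N → 𝕜) :
    MemLp (fun x => ∑ i, c i * u i x) 2 μ :=
  memLp_finsetSum _ fun i _ => (h.memLp i).const_mul (c i)

theorem measurable_sum (h : IsL2Orthonormal μ u) (c : Fin N → 𝕜) :
    Measurable fun x => ∑ i, c i * u i x :=
  Finset.measurable_fun_sum _ fun i _ => (h.measurable i).const_mul (c i)

theorem inner_sum (h : IsL2Orthonormal μ u) (c : Fin N → 𝕜) (j : Fin N) :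
    l2Inner μ (u j) (fun x => ∑ i, c i * u i x) = c j := by
  rw [l2Inner_sum_right c (h.memLp j) h.memLp]
  simp [h.inner_eq]

theorem inner_sum_left (h : IsL2Orthonormal μ u) (c : Fin N → 𝕜) {f : X → 𝕜} (hf : MemLp f 2 μ) :
    l2Inner μ (fun x => ∑ i, c i * u i x) f = ∑ i, (starRingEnd 𝕜) (c i) * l2Inner μ (u i) f := by
  rw [← conj_l2Inner, l2Inner_sum_right c hf h.memLp, map_sum]
  simp [conj_l2Inner]

theorem integral_norm_sq (h : IsL2Orthonormal μ u) (i : Fin N) : ∫ x, ‖u i x‖ ^ 2 ∂μ = 1 := by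
  have := h.inner_eq i i
  rw [l2Inner_self, if_pos rfl] at this
  exact_mod_cast this

theorem integrable_norm_sq (h : IsL2Orthonormal μ u) (i : Fin N) :
    Integrable (fun x => ‖u i x‖ ^ 2) μ :=
  (memLp_two_iff_integrable_sq_norm (h.memLp i).1).1 (h.memLp i)

/-- The normalized Christoffel function. -/
def density {Y : Type} (u : Fin N → Y → 𝕜) (x : Y) : ℝ := (∑ i, ‖u i x‖ ^ 2) / N

theorem density_nonneg {Y : Type} (u : Fin N → Y → 𝕜) (x : Y) : 0 ≤ density u x := by
  unfold density
  positivity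

theorem measurable_density (h : IsL2Orthonormal μ u) : Measurable (density u) :=
  (Finset.measurable_fun_sum _ fun i _ => (h.measurable i).norm.pow_const 2).div_const _

theorem integrable_density (h : IsL2Orthonormal μ u) : Integrable (density u) μ :=
  (integrable_finsetSum _ fun i _ => h.integrable_norm_sq i).div_const _

theorem integral_density (h : IsL2Orthonormal μ u) (hN : 0 < N) : ∫ x, density u x ∂μ = 1 := by
  have : (N : ℝ) ≠ 0 := by positivity
  unfold density
  rw [integral_div, integral_finsetSum _ fun i _ => h.integrable_norm_sq i]
  simp [h.integral_norm_sq, this]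

/-- The variance of one step of stochastic gradient descent with importance sampling, pointwise. -/
theorem density_mul_sum_le (hN : 0 < N) (e : Fin N → 𝕜) (γ : ℝ) (h : 𝕜) (x : X) :
    density u x *
        ∑ j, ‖e j - γ * ((starRingEnd 𝕜) (u j x) * h / (density u x : 𝕜))‖ ^ 2 ≤
      density u x * ∑ j, ‖e j‖ ^ 2 -
        2 * γ * RCLike.re ((starRingEnd 𝕜) (∑ j, e j * u j x) * h) + γ ^ 2 * N * ‖h‖ ^ 2 := by
  have hN' : (0 : ℝ) < N := by exact_mod_cast hN
  -- At a zero of the density all `u j` vanish and the right-hand side reduces to its nonnegative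
  -- last term. Elsewhere equality holds.
  rcases (density_nonneg u x).eq_or_lt with h0 | hpos
  · have hz : ∀ j, u j x = 0 := by
      have h1 : ∑ i, ‖u i x‖ ^ 2 = 0 := by
        have := h0.symm
        unfold density at this
        rcases div_eq_zero_iff.1 this with h2 | h2
        · exact h2
        · exact absurd h2 hN'.ne'
      intro j
      have := (Finset.sum_eq_zero_iff_of_nonneg fun i _ => sq_nonneg ‖u i x‖).1 h1 j
        (Finset.mem_univ j)
      simpa using this
    rw [← h0]
    simp only [hz, mul_zero, Finset.sum_const_zero, map_zero, zero_mul, sub_zero, zero_add]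
    positivity
  · have hs : ∑ j, ‖u j x‖ ^ 2 = N * density u x := by
      unfold density
      field_simp
    set l := density u x
    have hl : (l : 𝕜) ≠ 0 := by exact_mod_cast hpos.ne'
    have h1 : ∀ j, l * ‖e j - γ * ((starRingEnd 𝕜) (u j x) * h / (l : 𝕜))‖ ^ 2 =
        l * ‖e j‖ ^ 2 - 2 * γ * RCLike.re ((starRingEnd 𝕜) (e j * u j x) * h) +
          γ ^ 2 * (‖u j x‖ ^ 2 / l) * ‖h‖ ^ 2 := by
      intro j
      rw [← inner_self_eq_norm_sq (𝕜 := 𝕜), inner_sub_sub_self, map_add, map_sub, map_sub,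
        inner_self_eq_norm_sq (𝕜 := 𝕜), inner_self_eq_norm_sq (𝕜 := 𝕜),
        inner_re_symm (𝕜 := 𝕜) ((γ : 𝕜) * ((starRingEnd 𝕜) (u j x) * h / (l : 𝕜))) (e j)]
      have h2 : inner 𝕜 (e j) ((γ : 𝕜) * ((starRingEnd 𝕜) (u j x) * h / (l : 𝕜))) =
          ((γ / l : ℝ) : 𝕜) * ((starRingEnd 𝕜) (e j * u j x) * h) := by
        rw [RCLike.inner_apply]
        push_cast
        rw [map_mul]
        field_simp
      rw [h2, RCLike.re_ofReal_mul]
      have h3 : ‖(γ : 𝕜) * ((starRingEnd 𝕜) (u j x) * h / (l : 𝕜))‖ ^ 2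
          = γ ^ 2 * (‖u j x‖ ^ 2 * ‖h‖ ^ 2 / l ^ 2) := by
        simp only [norm_mul, norm_div, RCLike.norm_ofReal, RCLike.norm_conj, mul_pow, div_pow, sq_abs]
      rw [h3]
      field_simp
      ring
    rw [Finset.mul_sum, Finset.sum_congr rfl fun j _ => h1 j, Finset.sum_add_distrib,
      Finset.sum_sub_distrib, ← Finset.mul_sum, ← Finset.mul_sum, ← Finset.sum_mul,
      ← Finset.mul_sum, ← Finset.sum_div, hs, ← map_sum, map_sum (starRingEnd 𝕜), Finset.sum_mul]
    rw [mul_div_assoc, div_self hpos.ne', mul_one]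

/-- Here `e` is the current coefficient error and `g` the component outside the span, so a new
sample shows `h = g + ∑ e i u i`. By orthogonality the cross term integrates to `∑ ‖e j‖²` and
`‖h‖²` to `‖g‖² + ∑ ‖e j‖²`. -/
theorem lintegral_density_mul_sum_le [IsProbabilityMeasure μ] (hu : IsL2Orthonormal μ u)
    (hN : 0 < N) (e : Fin N → 𝕜) (γ : ℝ) {g : X → 𝕜} (hg : MemLp g 2 μ)
    (hgu : ∀ i, l2Inner μ (u i) g = 0) :
    ∫⁻ x, ENNReal.ofReal (density u x) * ENNReal.ofReal (∑ j,
        ‖e j - γ * ((starRingEnd 𝕜) (u j x) * (g x + ∑ i, e i * u i x) / (density u x : 𝕜))‖ ^ 2) ∂μ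
      ≤ ENNReal.ofReal ((1 - 2 * γ + γ ^ 2 * N) * ∑ j, ‖e j‖ ^ 2 +
          γ ^ 2 * N * ∫ x, ‖g x‖ ^ 2 ∂μ) := by
  let s : X → 𝕜 := fun x => ∑ i, e i * u i x
  have hs : MemLp s 2 μ := hu.memLp_sum e
  let h : X → 𝕜 := fun x => g x + s x
  have hh : MemLp h 2 μ := hg.add hs
  have hsh : l2Inner μ s h = ((∑ j, ‖e j‖ ^ 2 : ℝ) : 𝕜) := by
    rw [hu.inner_sum_left e hh]
    push_cast
    refine Finset.sum_congr rfl fun i _ => ?_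
    rw [l2Inner_add_right (hu.memLp i) hg hs, hgu, hu.inner_sum, zero_add, RCLike.conj_mul]
  have hgs : l2Inner μ g s = 0 := by
    rw [← conj_l2Inner, hu.inner_sum_left e hg]
    simp [hgu]
  have hgh : l2Inner μ g h = ((∫ x, ‖g x‖ ^ 2 ∂μ : ℝ) : 𝕜) := by
    rw [l2Inner_add_right hg hg hs, hgs, add_zero, l2Inner_self]
  have hhh : ∫ x, ‖h x‖ ^ 2 ∂μ = ∫ x, ‖g x‖ ^ 2 ∂μ + ∑ j, ‖e j‖ ^ 2 := by
    have h1 : l2Inner μ h h = l2Inner μ g h + l2Inner μ s h := by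
      rw [← conj_l2Inner, l2Inner_add_right hh hg hs, map_add, conj_l2Inner, conj_l2Inner]
    rw [l2Inner_self, hgh, hsh] at h1
    exact_mod_cast h1
  have hshi := hs.integrable_conj_mul hh
  have hhi : Integrable (fun x => ‖h x‖ ^ 2) μ :=
    (memLp_two_iff_integrable_sq_norm hh.1).1 hh
  let Q : X → ℝ := fun x => density u x * ∑ j, ‖e j‖ ^ 2 -
        2 * γ * RCLike.re ((starRingEnd 𝕜) (s x) * h x) + γ ^ 2 * N * ‖h x‖ ^ 2
  have hQ1 : Integrable (fun x => density u x * ∑ j, ‖e j‖ ^ 2) μ := hu.integrable_density.mul_const _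
  have hQ2 : Integrable (fun x => 2 * γ * RCLike.re ((starRingEnd 𝕜) (s x) * h x)) μ :=
    hshi.re.const_mul _
  have hQ3 : Integrable (fun x => γ ^ 2 * N * ‖h x‖ ^ 2) μ := hhi.const_mul _
  have hQ12 : Integrable (fun x => density u x * ∑ j, ‖e j‖ ^ 2 -
      2 * γ * RCLike.re ((starRingEnd 𝕜) (s x) * h x)) μ := hQ1.sub hQ2
  have hQi : Integrable Q μ := hQ12.add hQ3
  have hpt := fun x => density_mul_sum_le (u := u) hN e γ (h x) x
  have hQ0 : ∀ x, 0 ≤ Q x := fun x => by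
    refine le_trans ?_ (hpt x)
    exact mul_nonneg (density_nonneg u x) (Finset.sum_nonneg fun j _ => by positivity)
  calc _ ≤ ∫⁻ x, ENNReal.ofReal (Q x) ∂μ := by
        refine lintegral_mono fun x => ?_
        rw [← ENNReal.ofReal_mul (density_nonneg u x)]
        exact ENNReal.ofReal_le_ofReal (hpt x)
    _ = ENNReal.ofReal (∫ x, Q x ∂μ) :=
        (ofReal_integral_eq_lintegral_ofReal hQi (ae_of_all _ hQ0)).symm
    _ = _ := by
        congr 1
        have h1 : ∫ x, Q x ∂μ = (∑ j, ‖e j‖ ^ 2) - 2 * γ * (∑ j, ‖e j‖ ^ 2) +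
            γ ^ 2 * N * (∫ x, ‖g x‖ ^ 2 ∂μ + ∑ j, ‖e j‖ ^ 2) := by
          have h2 : ∫ x, RCLike.re ((starRingEnd 𝕜) (s x) * h x) ∂μ = ∑ j, ‖e j‖ ^ 2 := by
            rw [integral_re hshi]
            have := congrArg RCLike.re hsh
            rwa [RCLike.ofReal_re] at this
          simp only [Q]
          rw [integral_add hQ12 hQ3, integral_sub hQ1 hQ2, integral_mul_const,
            hu.integral_density hN, integral_const_mul, integral_const_mul, h2, hhh, one_mul]
        rw [h1]
        ring

end IsL2Orthonormal

/-- The Andréief identity for an orthogonal family. -/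
theorem lintegral_norm_det_sq [IsProbabilityMeasure μ] {N : ℕ} {φ : Fin N → X → 𝕜}
    (hφ : ∀ i, MemLp (φ i) 2 μ) (horth : ∀ i j, i ≠ j → l2Inner μ (φ i) (φ j) = 0) :
    ∫⁻ x, ENNReal.ofReal (‖(Matrix.of fun i j => φ i (x j)).det‖ ^ 2) ∂(Measure.pi fun _ : Fin N => μ) =
      ENNReal.ofReal (N.factorial * ∏ i, ∫ y, ‖φ i y‖ ^ 2 ∂μ) := by
  let D : (Fin N → X) → 𝕜 := fun x => (Matrix.of fun i j => φ i (x j)).det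
  have hexp : ∀ x, (starRingEnd 𝕜) (D x) * D x = ∑ τ : Equiv.Perm (Fin N), ∑ π : Equiv.Perm (Fin N),
      (((Equiv.Perm.sign τ : ℤ) : 𝕜) * ((Equiv.Perm.sign π : ℤ) : 𝕜)) *
        ∏ i, ((starRingEnd 𝕜) (φ (τ i) (x i)) * φ (π i) (x i)) := by
    intro x
    simp only [D, Matrix.det_apply', map_sum, Finset.sum_mul_sum, map_mul, map_prod,
      Finset.prod_mul_distrib, Matrix.of_apply]
    refine Finset.sum_congr rfl fun τ _ => Finset.sum_congr rfl fun π _ => ?_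
    rw [map_intCast]
    ring
  have hint : ∀ τ π : Equiv.Perm (Fin N), Integrable (fun x : Fin N → X =>
      (((Equiv.Perm.sign τ : ℤ) : 𝕜) * ((Equiv.Perm.sign π : ℤ) : 𝕜)) *
        ∏ i, ((starRingEnd 𝕜) (φ (τ i) (x i)) * φ (π i) (x i))) (Measure.pi fun _ => μ) := fun τ π =>
    (Integrable.fintype_prod (f := fun i y => (starRingEnd 𝕜) (φ (τ i) y) * φ (π i) y)
      fun i => (hφ (τ i)).integrable_conj_mul (hφ (π i))).const_mul _
  have hnorm : ∀ x, ((‖D x‖ ^ 2 : ℝ) : 𝕜) = (starRingEnd 𝕜) (D x) * D x := fun x => by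
    rw [RCLike.conj_mul]
    norm_cast
  have hDi : Integrable (fun x => ‖D x‖ ^ 2) (Measure.pi fun _ : Fin N => μ) := by
    have h1 : Integrable (fun x => (starRingEnd 𝕜) (D x) * D x) (Measure.pi fun _ : Fin N => μ) := by
      simp only [hexp]
      exact integrable_finsetSum _ fun τ _ => integrable_finsetSum _ fun π _ => hint τ π
    refine h1.re.congr (ae_of_all _ fun x => ?_)
    simp only [← hnorm, RCLike.ofReal_re]
  have hval : ∫ x, ‖D x‖ ^ 2 ∂(Measure.pi fun _ : Fin N => μ) =
      N.factorial * ∏ i, ∫ y, ‖φ i y‖ ^ 2 ∂μ := by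
    have h2 : ((∫ x, ‖D x‖ ^ 2 ∂(Measure.pi fun _ : Fin N => μ) : ℝ) : 𝕜) =
        ((N.factorial * ∏ i, ∫ y, ‖φ i y‖ ^ 2 ∂μ : ℝ) : 𝕜) := by
      rw [← integral_ofReal]
      simp only [hnorm, hexp]
      rw [integral_finsetSum _ fun τ _ => integrable_finsetSum _ fun π _ => hint τ π]
      have h3 : ∀ τ : Equiv.Perm (Fin N), ∫ x : Fin N → X, ∑ π : Equiv.Perm (Fin N),
          (((Equiv.Perm.sign τ : ℤ) : 𝕜) * ((Equiv.Perm.sign π : ℤ) : 𝕜)) *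
            ∏ i, ((starRingEnd 𝕜) (φ (τ i) (x i)) * φ (π i) (x i)) ∂(Measure.pi fun _ => μ) =
          ((∏ i, ∫ y, ‖φ i y‖ ^ 2 ∂μ : ℝ) : 𝕜) := by
        intro τ
        rw [integral_finsetSum _ fun π _ => hint τ π, Finset.sum_eq_single τ]
        · rw [integral_const_mul, integral_fintype_prod_eq_prod
            (f := fun i y => (starRingEnd 𝕜) (φ (τ i) y) * φ (τ i) y)]
          have h4 : ((Equiv.Perm.sign τ : ℤ) : 𝕜) * ((Equiv.Perm.sign τ : ℤ) : 𝕜) = 1 := by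
            rw [← Int.cast_mul, ← Units.val_mul, Int.units_mul_self]
            simp
          rw [h4, one_mul]
          rw [RCLike.ofReal_prod,
            ← Equiv.prod_comp τ fun i => ((∫ y, ‖φ i y‖ ^ 2 ∂μ : ℝ) : 𝕜)]
          exact Finset.prod_congr rfl fun i _ => l2Inner_self
        -- Two different permutations disagree at some index, where orthogonality makes a factor
        -- vanish. Only the `N!` diagonal terms remain.
        · intro π _ hπ
          obtain ⟨i, hi⟩ : ∃ i, π i ≠ τ i := by
            by_contra! hcon
            exact hπ (Equiv.ext hcon)
          rw [integral_const_mul, integral_fintype_prod_eq_prod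
            (f := fun i y => (starRingEnd 𝕜) (φ (τ i) y) * φ (π i) y),
            Finset.prod_eq_zero (Finset.mem_univ i) (horth _ _ hi.symm), mul_zero]
        · simp
      rw [Finset.sum_congr rfl fun τ _ => h3 τ]
      simp [Fintype.card_perm]
    exact_mod_cast h2
  rw [← hval, ofReal_integral_eq_lintegral_ofReal hDi (ae_of_all _ fun x => by positivity)]

end SquareIntegrable

/-! ### Estimating coefficients from random function values. -/

/-- A randomized method for the estimation of `N` coefficients from `n` function values at random
points. -/
structure SampleScheme (𝕜 X : Type) [RCLike 𝕜] [MeasurableSpace X] (N : ℕ) where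
  Ω : Type
  [measurableSpace : MeasurableSpace Ω]
  P : Measure Ω
  [isProbabilityMeasure : IsProbabilityMeasure P]
  n : ℕ
  pts : Ω → ℕ → X
  measurable_pts : ∀ l, Measurable fun ω => pts ω l
  coef : Ω → (ℕ → 𝕜) → Fin N → 𝕜
  measurable_coef : ∀ j, Measurable fun q : Ω × (ℕ → 𝕜) => coef q.1 q.2 j
  coef_congr : ∀ ω y y', (∀ l < n, y l = y' l) → coef ω y = coef ω y'

attribute [instance] SampleScheme.measurableSpace SampleScheme.isProbabilityMeasure

namespace SampleScheme

variable {𝕜 X : Type} [RCLike 𝕜] [MeasurableSpace X] {N : ℕ} {μ : Measure X}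

/-- The estimated coefficients of `f`. -/
def estimate (s : SampleScheme 𝕜 X N) (f : X → 𝕜) (ω : s.Ω) : Fin N → 𝕜 :=
  s.coef ω fun l => f (s.pts ω l)

theorem measurable_estimate (s : SampleScheme 𝕜 X N) {f : X → 𝕜} (hf : Measurable f) (j : Fin N) :
    Measurable fun ω => s.estimate f ω j := by
  refine (s.measurable_coef j).comp (measurable_id.prodMk ?_)
  exact measurable_pi_lambda _ fun l => hf.comp (s.measurable_pts l)

/-- The part of `f` that is orthogonal to the family `u`. -/
def residual (μ : Measure X) (u : Fin N → X → 𝕜) (f : X → 𝕜) (x : X) : 𝕜 :=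
  f x - ∑ j, l2Inner μ (u j) f * u j x

theorem memLp_residual {u : Fin N → X → 𝕜} (hu : IsL2Orthonormal μ u) {f : X → 𝕜}
    (hf : MemLp f 2 μ) : MemLp (residual μ u f) 2 μ :=
  hf.sub (hu.memLp_sum _)

theorem measurable_residual {u : Fin N → X → 𝕜} (hu : IsL2Orthonormal μ u) {f : X → 𝕜}
    (hf : Measurable f) : Measurable (residual μ u f) :=
  hf.sub (hu.measurable_sum _)

theorem l2Inner_residual {u : Fin N → X → 𝕜} (hu : IsL2Orthonormal μ u) {f : X → 𝕜}
    (hf : MemLp f 2 μ) (i : Fin N) : l2Inner μ (u i) (residual μ u f) = 0 := by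
  have h1 := l2Inner_add_right (hu.memLp i) (memLp_residual hu hf)
    (hu.memLp_sum fun j => l2Inner μ (u j) f)
  simp only [residual, sub_add_cancel] at h1
  rw [hu.inner_sum] at h1
  change l2Inner μ (u i) f = l2Inner μ (u i) (residual μ u f) + l2Inner μ (u i) f at h1
  simpa using h1

/-- The mean square error of the estimated coefficients is at most `B` times the square of the
distance to the span of `u`. -/
def HasVariance (s : SampleScheme 𝕜 X N) (μ : Measure X) (u : Fin N → X → 𝕜) (B : ℝ) : Prop :=
  ∀ f : X → 𝕜, Measurable f → MemLp f 2 μ →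
    ∫⁻ ω, ENNReal.ofReal (∑ j, ‖l2Inner μ (u j) f - s.estimate f ω j‖ ^ 2) ∂s.P ≤
      ENNReal.ofReal (B * ∫ x, ‖residual μ u f x‖ ^ 2 ∂μ)

theorem measurable_det_of {ι Y : Type*} [Fintype ι] [DecidableEq ι] [MeasurableSpace Y]
    {M : Y → ι → ι → 𝕜} (hM : ∀ i j, Measurable fun y => M y i j) :
    Measurable fun y => (Matrix.of (M y)).det := by
  simp only [Matrix.det_apply', Matrix.of_apply]
  exact Finset.measurable_fun_sum _ fun σ _ =>
    (Finset.measurable_fun_prod _ fun i _ => hM _ _).const_mul _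

variable [IsProbabilityMeasure μ] {u : Fin N → X → 𝕜}

/-- Interpolation at the points of a projection determinantal point process. -/
theorem exists_interpolation (hu : IsL2Orthonormal μ u) (hN : 0 < N) :
    ∃ s : SampleScheme 𝕜 X N, s.n = N ∧ s.HasVariance μ u N := by
  let U : (Fin N → X) → Matrix (Fin N) (Fin N) 𝕜 := fun ω => Matrix.of fun i j => u i (ω j)
  have hUdet : Measurable fun ω => (U ω).det :=
    measurable_det_of fun i j => (hu.measurable i).comp (measurable_pi_apply j)
  -- The density of the determinantal process; the Andréief identity shows that its mass is `1`.
  let ρ : (Fin N → X) → ℝ≥0∞ := fun ω => ENNReal.ofReal (‖(U ω).det‖ ^ 2 / N.factorial)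
  have hρ : Measurable ρ := ((hUdet.norm.pow_const 2).div_const _).ennreal_ofReal
  have hfac : (0 : ℝ) < N.factorial := by exact_mod_cast N.factorial_pos
  have hdet : ∀ {φ : Fin N → X → 𝕜}, (∀ i, MemLp (φ i) 2 μ) →
      (∀ i j, i ≠ j → l2Inner μ (φ i) (φ j) = 0) →
      ∫⁻ ω, ENNReal.ofReal (‖(Matrix.of fun i j => φ i (ω j)).det‖ ^ 2 / N.factorial)
        ∂(Measure.pi fun _ : Fin N => μ) = ENNReal.ofReal (∏ i, ∫ y, ‖φ i y‖ ^ 2 ∂μ) := by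
    intro φ h1 h2
    simp only [div_eq_mul_inv]
    simp only [ENNReal.ofReal_mul (sq_nonneg _)]
    rw [lintegral_mul_const' _ _ (by finiteness), lintegral_norm_det_sq h1 h2,
      ← ENNReal.ofReal_mul (by positivity)]
    congr 1
    field_simp
  have hprob : IsProbabilityMeasure ((Measure.pi fun _ : Fin N => μ).withDensity ρ) := by
    constructor
    rw [withDensity_apply _ MeasurableSet.univ, setLIntegral_univ]
    rw [hdet hu.memLp fun i j hij => by rw [hu.inner_eq, if_neg hij]]
    simp [hu.integral_norm_sq]
  -- Cramer's rule: the `j`th coefficient of the interpolant is the quotient of determinants with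
  -- row `j` replaced by the observed values.
  let V : Fin N → (Fin N → X) → (ℕ → 𝕜) → Fin N → Fin N → 𝕜 := fun j ω y i l =>
    if i = j then y l else u i (ω l)
  refine ⟨{
    Ω := Fin N → X
    P := (Measure.pi fun _ : Fin N => μ).withDensity ρ
    n := N
    pts := fun ω l => if h : l < N then ω ⟨l, h⟩ else ω ⟨0, hN⟩
    measurable_pts := fun l => ?_
    coef := fun ω y j => (Matrix.of (V j ω y)).det / (U ω).det
    measurable_coef := fun j => ?_
    coef_congr := fun ω y y' h => ?_ }, rfl, fun f hfm hf => ?_⟩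
  · by_cases h : l < N
    · simp only [h, dif_pos]
      exact measurable_pi_apply _
    · simp only [h, dif_neg, not_false_eq_true]
      exact measurable_pi_apply _
  · refine (measurable_det_of (M := fun q : (Fin N → X) × (ℕ → 𝕜) => V j q.1 q.2)
      fun i l => ?_).div (hUdet.comp measurable_fst)
    by_cases hij : i = j
    · simp only [V, hij, if_true]
      exact (measurable_pi_apply (l : ℕ)).comp measurable_snd
    · simp only [V, hij, if_false]
      exact (hu.measurable i).comp ((measurable_pi_apply l).comp measurable_fst)
  · ext j
    have : V j ω y = V j ω y' := by
      ext i l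
      simp only [V]
      rw [h l l.2]
    rw [this]
  · let g := residual μ u f
    have hg : MemLp g 2 μ := memLp_residual hu hf
    let c : Fin N → 𝕜 := fun j => l2Inner μ (u j) f
    let W : Fin N → (Fin N → X) → Matrix (Fin N) (Fin N) 𝕜 := fun j ω =>
      Matrix.of fun i l => Function.update u j g i (ω l)
    have hfg : ∀ x, f x = (∑ k, c k * u k x) + g x := fun x => by
      simp only [g, residual, c]
      ring
    -- Expanding row `j` of `f = ∑ c k u k + g` leaves `c j` plus `det W / det U`. Against the
    -- sampling density `|det U|²` cancels, and the Andréief identity applies to `u` with `u j`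
    -- replaced by `g`.
    have hcoef : ∀ ω j, (U ω).det ≠ 0 →
        ‖c j - (Matrix.of (V j ω fun l => f (if h : l < N then ω ⟨l, h⟩ else ω ⟨0, hN⟩))).det /
          (U ω).det‖ ^ 2 = ‖(W j ω).det‖ ^ 2 / ‖(U ω).det‖ ^ 2 := by
      intro ω j h0
      have h1 : Matrix.of (V j ω fun l => f (if h : l < N then ω ⟨l, h⟩ else ω ⟨0, hN⟩)) =
          (U ω).updateRow j ((∑ k, c k • U ω k) + fun l => g (ω l)) := by
        ext i l
        by_cases hij : i = j
        · subst hij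
          simp [V, hfg, U, Finset.sum_apply]
        · simp [V, hij, U]
      have h2 : W j ω = (U ω).updateRow j fun l => g (ω l) := by
        ext i l
        by_cases hij : i = j
        · subst hij
          simp [W]
        · simp [W, hij, U]
      rw [h1, Matrix.det_updateRow_add, Matrix.det_updateRow_sum, ← h2, smul_eq_mul, add_div,
        mul_div_cancel_right₀ _ h0, sub_add_cancel_left, norm_neg, norm_div, div_pow]
    have hWm : ∀ j, Measurable fun ω => ENNReal.ofReal (‖(W j ω).det‖ ^ 2 / N.factorial) := by
      intro j
      refine Measurable.ennreal_ofReal (((measurable_det_of fun i l => ?_).norm.pow_const 2).div_const _)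
      have : Measurable (Function.update u j g i) := by
        by_cases hij : i = j
        · subst hij
          simpa using measurable_residual hu hfm
        · simpa [hij] using hu.measurable i
      exact this.comp (measurable_pi_apply l)
    have hWint : ∀ j, ∫⁻ ω, ENNReal.ofReal (‖(W j ω).det‖ ^ 2 / N.factorial)
        ∂(Measure.pi fun _ : Fin N => μ) = ENNReal.ofReal (∫ x, ‖g x‖ ^ 2 ∂μ) := by
      intro j
      rw [hdet]
      · congr 1
        rw [Finset.prod_eq_single j]
        · simp
        · intro i _ hij
          simpa [hij] using hu.integral_norm_sq i
        · simp
      · intro i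
        by_cases hij : i = j
        · subst hij
          simpa using hg
        · simpa [hij] using hu.memLp i
      · intro i k hik
        by_cases hij : i = j
        · subst hij
          rw [Function.update_self, Function.update_of_ne hik.symm, ← conj_l2Inner,
            l2Inner_residual hu hf, map_zero]
        · by_cases hkj : k = j
          · subst hkj
            rw [Function.update_self, Function.update_of_ne hik, l2Inner_residual hu hf]
          · rw [Function.update_of_ne hij, Function.update_of_ne hkj, hu.inner_eq, if_neg hik]
    refine (lintegral_withDensity_le_lintegral_mul _ hρ _).trans ?_
    calc _ ≤ ∫⁻ ω, ∑ j, ENNReal.ofReal (‖(W j ω).det‖ ^ 2 / N.factorial)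
            ∂(Measure.pi fun _ : Fin N => μ) := by
          refine lintegral_mono fun ω => ?_
          simp only [Pi.mul_apply, ρ]
          rw [← ENNReal.ofReal_mul (by positivity),
            ← ENNReal.ofReal_sum_of_nonneg fun j _ => by positivity]
          refine ENNReal.ofReal_le_ofReal ?_
          -- Singular configurations have density zero, so the value of the quotient there is
          -- irrelevant.
          by_cases h0 : (U ω).det = 0
          · rw [h0]
            simp only [norm_zero]
            rw [zero_pow two_ne_zero, zero_div, zero_mul]
            exact Finset.sum_nonneg fun j _ => by positivity
          · rw [Finset.mul_sum]
            refine Finset.sum_le_sum fun j _ => ?_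
            refine (congrArg _ (hcoef ω j h0)).le.trans (le_of_eq ?_)
            have : ‖(U ω).det‖ ≠ 0 := norm_ne_zero_iff.2 h0
            field_simp
      _ = ∑ j : Fin N, ENNReal.ofReal (∫ x, ‖g x‖ ^ 2 ∂μ) := by
          rw [lintegral_finsetSum _ fun j _ => hWm j]
          exact Finset.sum_congr rfl fun j _ => hWint j
      _ = _ := by
          rw [Finset.sum_const, Finset.card_univ, Fintype.card_fin, nsmul_eq_mul,
            ENNReal.ofReal_mul (by positivity), ENNReal.ofReal_natCast]

/-- One more sample from the Christoffel density improves the estimate. -/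
theorem exists_step (hu : IsL2Orthonormal μ u) (hN : 0 < N) (s : SampleScheme 𝕜 X N) {B : ℝ}
    (hB : 0 ≤ B) (hs : s.HasVariance μ u B) {a : ℝ} (ha : 0 < a) (ha1 : a ≤ 1) :
    ∃ s' : SampleScheme 𝕜 X N, s'.n = s.n + 1 ∧
      s'.HasVariance μ u ((1 - a / N) * B + a ^ 2 / N) := by
  have hN' : (1 : ℝ) ≤ N := by exact_mod_cast hN
  let l := IsL2Orthonormal.density u
  let ν : Measure X := μ.withDensity fun x => ENNReal.ofReal (l x)
  have hlm : Measurable fun x => ENNReal.ofReal (l x) := hu.measurable_density.ennreal_ofReal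
  have hν : IsProbabilityMeasure ν := by
    constructor
    rw [withDensity_apply _ MeasurableSet.univ, setLIntegral_univ,
      ← ofReal_integral_eq_lintegral_ofReal hu.integrable_density
        (ae_of_all _ (IsL2Orthonormal.density_nonneg u)), hu.integral_density hN, ENNReal.ofReal_one]
  refine ⟨{
    Ω := s.Ω × X
    P := s.P.prod ν
    n := s.n + 1
    pts := fun q k => if k < s.n then s.pts q.1 k else q.2
    measurable_pts := fun k => ?_
    -- A gradient step of size `a/N`: the residual at the new point `q.2`, whose value is `y s.n`,
    -- is weighted by the inverse density.
    coef := fun q y j => s.coef q.1 y j + ((a / N : ℝ) : 𝕜) *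
      ((starRingEnd 𝕜) (u j q.2) * (y s.n - ∑ i, s.coef q.1 y i * u i q.2) / (l q.2 : 𝕜))
    measurable_coef := fun j => ?_
    coef_congr := fun q y y' h => ?_ }, rfl, fun f hfm hf => ?_⟩
  · by_cases h : k < s.n
    · simp only [h, if_true]
      exact (s.measurable_pts k).comp measurable_fst
    · simp only [h, if_false]
      exact measurable_snd
  · have hc : ∀ i, Measurable fun q : (s.Ω × X) × (ℕ → 𝕜) => s.coef q.1.1 q.2 i := fun i =>
      (s.measurable_coef i).comp ((measurable_fst.comp measurable_fst).prodMk measurable_snd)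
    have hx : Measurable fun q : (s.Ω × X) × (ℕ → 𝕜) => q.1.2 := measurable_snd.comp measurable_fst
    have hui : ∀ i, Measurable fun q : (s.Ω × X) × (ℕ → 𝕜) => u i q.1.2 := fun i =>
      (hu.measurable i).comp hx
    refine (hc j).add (Measurable.const_mul (Measurable.div (Measurable.mul ?_ ?_) ?_) _)
    · exact RCLike.continuous_conj.measurable.comp (hui j)
    · refine Measurable.sub ((measurable_pi_apply s.n).comp measurable_snd) ?_
      exact Finset.measurable_fun_sum _ fun i _ => (hc i).mul (hui i)
    · exact RCLike.measurable_ofReal.comp (hu.measurable_density.comp hx)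
  · have h1 : s.coef q.1 y = s.coef q.1 y' := s.coef_congr _ _ _ fun k hk => h k (by omega)
    ext j
    rw [h1, h s.n (by omega)]
  · let g := residual μ u f
    let c : Fin N → 𝕜 := fun j => l2Inner μ (u j) f
    let e : s.Ω → Fin N → 𝕜 := fun ω j => c j - s.estimate f ω j
    have hem : ∀ j, Measurable fun ω => e ω j := fun j =>
      (s.measurable_estimate hfm j).const_sub (c j)
    have hfg : ∀ x, f x = g x + ∑ k, c k * u k x := fun x => by
      simp only [g, residual, c]
      ring
    let E : s.Ω × X → ℝ≥0∞ := fun q => ENNReal.ofReal (∑ j, ‖e q.1 j - ((a / N : ℝ) : 𝕜) *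
      ((starRingEnd 𝕜) (u j q.2) * (g q.2 + ∑ i, e q.1 i * u i q.2) / (l q.2 : 𝕜))‖ ^ 2)
    have hEm : Measurable E := by
      have hem' : ∀ j, Measurable fun q : s.Ω × X => e q.1 j := fun j =>
        (hem j).comp measurable_fst
      have hum : ∀ j, Measurable fun q : s.Ω × X => u j q.2 := fun j =>
        (hu.measurable j).comp measurable_snd
      refine Measurable.ennreal_ofReal (Finset.measurable_fun_sum _ fun j _ =>
        Measurable.pow_const (Measurable.norm ((hem' j).sub
          (Measurable.const_mul (Measurable.div (Measurable.mul ?_ ?_) ?_) _))) 2)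
      · exact RCLike.continuous_conj.measurable.comp (hum j)
      · exact ((measurable_residual hu hfm).comp measurable_snd).add
          (Finset.measurable_fun_sum _ fun i _ => (hem' i).mul (hum i))
      · exact RCLike.measurable_ofReal.comp (hu.measurable_density.comp measurable_snd)
    have hE : ∀ q : s.Ω × X, ∀ j, c j - (s.coef q.1 (fun k => f (if k < s.n then s.pts q.1 k else q.2)) j
        + ((a / N : ℝ) : 𝕜) * ((starRingEnd 𝕜) (u j q.2) *
          (f (if s.n < s.n then s.pts q.1 s.n else q.2) - ∑ i, s.coef q.1
            (fun k => f (if k < s.n then s.pts q.1 k else q.2)) i * u i q.2) / (l q.2 : 𝕜))) =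
        e q.1 j - ((a / N : ℝ) : 𝕜) *
          ((starRingEnd 𝕜) (u j q.2) * (g q.2 + ∑ i, e q.1 i * u i q.2) / (l q.2 : 𝕜)) := by
      intro q j
      have h1 : s.coef q.1 (fun k => f (if k < s.n then s.pts q.1 k else q.2)) =
          s.estimate f q.1 := s.coef_congr _ _ _ fun k hk => by simp [hk]
      have h2 : g q.2 + ∑ i, e q.1 i * u i q.2 = f q.2 - ∑ i, s.estimate f q.1 i * u i q.2 := by
        rw [hfg]
        simp only [e, sub_mul, Finset.sum_sub_distrib]
        ring
      rw [h1, h2, if_neg (lt_irrefl _)]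
      simp only [e]
      ring
    set r := ∫ x, ‖g x‖ ^ 2 ∂μ with hr
    have hr0 : 0 ≤ r := integral_nonneg fun x => by positivity
    have haN : 0 ≤ 1 - a / N := by
      rw [sub_nonneg, div_le_one (by positivity)]
      linarith
    have hinner : ∀ ω, ∫⁻ x, E (ω, x) ∂ν ≤
        ENNReal.ofReal (1 - a / N) * ENNReal.ofReal (∑ j, ‖e ω j‖ ^ 2) +
          ENNReal.ofReal (a ^ 2 / N * r) := by
      intro ω
      refine (lintegral_withDensity_le_lintegral_mul _ hlm _).trans ?_
      refine (hu.lintegral_density_mul_sum_le hN (e ω) (a / N) (memLp_residual hu hf)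
        (l2Inner_residual hu hf)).trans ?_
      have h2 : 0 ≤ ∑ j, ‖e ω j‖ ^ 2 := Finset.sum_nonneg fun j _ => by positivity
      rw [← ENNReal.ofReal_mul haN, ← ENNReal.ofReal_add (by positivity) (by positivity)]
      refine ENNReal.ofReal_le_ofReal ?_
      have h3 : (a / N) ^ 2 * N = a ^ 2 / N := by field_simp
      -- Since `a ≤ 1`, the contraction factor `1 - 2a/N + a²/N` is at most `1 - a/N`.
      have h4 : a ^ 2 / N ≤ a / N := by
        gcongr
        nlinarith
      rw [h3]
      gcongr
      linarith
    change ∫⁻ q : s.Ω × X, ENNReal.ofReal (∑ j, ‖c j - (_ : 𝕜)‖ ^ 2) ∂(s.P.prod ν) ≤ _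
    calc _ = ∫⁻ q, E q ∂(s.P.prod ν) := by
          refine lintegral_congr fun q => ?_
          refine congrArg ENNReal.ofReal (Finset.sum_congr rfl fun j _ => ?_)
          exact congrArg (fun z => ‖z‖ ^ 2) (hE q j)
      _ = ∫⁻ ω, ∫⁻ x, E (ω, x) ∂ν ∂s.P := lintegral_prod _ hEm.aemeasurable
      _ ≤ ∫⁻ ω, (ENNReal.ofReal (1 - a / N) * ENNReal.ofReal (∑ j, ‖e ω j‖ ^ 2) +
          ENNReal.ofReal (a ^ 2 / N * r)) ∂s.P := lintegral_mono hinner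
      _ = ENNReal.ofReal (1 - a / N) * (∫⁻ ω, ENNReal.ofReal (∑ j, ‖e ω j‖ ^ 2) ∂s.P) +
          ENNReal.ofReal (a ^ 2 / N * r) := by
          rw [lintegral_add_right _ measurable_const, lintegral_const_mul' _ _ (by finiteness)]
          simp
      _ ≤ ENNReal.ofReal (1 - a / N) * ENNReal.ofReal (B * r) + ENNReal.ofReal (a ^ 2 / N * r) := by
          gcongr
          exact hs f hfm hf
      _ = _ := by
          rw [← ENNReal.ofReal_mul haN, ← ENNReal.ofReal_add (by positivity) (by positivity)]
          congr 1
          ring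

/-- Coefficients with respect to an orthonormal family can be estimated from `N + T` function
values. -/
theorem exists_hasVariance (hu : IsL2Orthonormal μ u) (hN : 0 < N) {a : ℝ} (ha : 0 < a)
    (ha1 : a ≤ 1) (T : ℕ) :
    ∃ s : SampleScheme 𝕜 X N, s.n = N + T ∧ s.HasVariance μ u (a + (1 - a / N) ^ T * N) := by
  have hN' : (1 : ℝ) ≤ N := by exact_mod_cast hN
  have haN : 0 ≤ 1 - a / N := by
    rw [sub_nonneg, div_le_one (by positivity)]
    linarith
  induction T with
  | zero =>
    obtain ⟨s, hs, hv⟩ := exists_interpolation hu hN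
    refine ⟨s, hs, fun f hfm hf => (hv f hfm hf).trans (ENNReal.ofReal_le_ofReal ?_)⟩
    have : 0 ≤ ∫ x, ‖residual μ u f x‖ ^ 2 ∂μ := integral_nonneg fun x => by positivity
    gcongr
    simpa using ha.le
  | succ T ih =>
    obtain ⟨s, hs, hv⟩ := ih
    obtain ⟨s', hs', hv'⟩ := exists_step hu hN s (by positivity) hv ha ha1
    refine ⟨s', by omega, ?_⟩
    -- The recursion `B ↦ (1 - a/N) B + a²/N` has the fixed point `a`, and the excess over `a`
    -- shrinks by the factor `1 - a/N`.
    convert hv' using 1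
    rw [pow_succ, show a ^ 2 / (N : ℝ) = a * (a / N) by ring]
    ring

end SampleScheme

/-! ### Sample schemes as algorithms for the embedding. -/

namespace ApproxProblem

variable {𝕜 : Type} [RCLike 𝕜] {d : ℕ} (S : ApproxProblem 𝕜 d)

instance isProbabilityMeasure_weight : IsProbabilityMeasure S.weight := by
  constructor
  rw [weight, withDensity_apply _ MeasurableSet.univ, setLIntegral_univ]
  exact S.lintegral_ρ

/-- The domain with the `σ`-algebra of null measurable sets, for which all elements of `F` are
measurable. -/
abbrev Points : Type := NullMeasurableSpace S.D S.weight

instance isProbabilityMeasure_completion : IsProbabilityMeasure S.weight.completion :=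
  ⟨(measure_univ : S.weight univ = 1)⟩

/-- The elements of `F` as functions on `Points`. -/
def evalPoints (f : S.F) : S.Points → 𝕜 := S.eval f

theorem evalPoints_sub_sum {N : ℕ} (f : S.F) (c : Fin N → 𝕜) (w : Fin N → S.F) (x : S.Points) :
    S.evalPoints (f - ∑ j, c j • w j) x = S.evalPoints f x - ∑ j, c j * S.evalPoints (w j) x := by
  have h : ∀ y : S.D, S.eval (f - ∑ j, c j • w j) y = S.eval f y - ∑ j, c j * S.eval (w j) y :=
    fun y => by simp
  exact h x

theorem nonempty_D : Nonempty S.D := by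
  by_contra h
  have h2 : S.weight univ = 0 := by
    rw [not_nonempty_iff] at h
    rw [univ_eq_empty_iff.2 h, measure_empty]
  rw [measure_univ] at h2
  exact one_ne_zero h2

/-- Square integrability gives measurability only up to null sets, whereas evaluation at a random
point needs a measurable function. Passing to the completion closes this gap without changing any
function value. -/
theorem measurable_evalPoints (f : S.F) : Measurable (S.evalPoints f) :=
  ((S.memLp f).aestronglyMeasurable.aemeasurable.nullMeasurable).measurable'

/-- The identity map to the domain with the Borel `σ`-algebra. -/
def ofPoints : S.Points → S.D := id

theorem measurePreserving_ofPoints :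
    MeasurePreserving S.ofPoints S.weight.completion S.weight := by
  have hm : Measurable S.ofPoints := fun s hs => MeasurableSet.nullMeasurableSet hs
  refine ⟨hm, ?_⟩
  ext s hs
  rw [Measure.map_apply hm hs]
  rfl

theorem memLp_evalPoints (f : S.F) : MemLp (S.evalPoints f) 2 S.weight.completion :=
  MemLp.comp_measurePreserving (S.memLp f) S.measurePreserving_ofPoints

theorem inner_app (f g : S.F) : inner 𝕜 (S.app f) (S.app g) =
    l2Inner S.weight.completion (S.evalPoints f) (S.evalPoints g) := by
  have hi : Integrable (fun x => (starRingEnd 𝕜) (S.eval f x) * S.eval g x) S.weight :=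
    MemLp.integrable_conj_mul (S.memLp f) (S.memLp g)
  have h1 : l2Inner S.weight.completion (S.evalPoints f) (S.evalPoints g) =
      ∫ x, (starRingEnd 𝕜) (S.eval f x) * S.eval g x ∂S.weight := by
    have hp := S.measurePreserving_ofPoints
    have h2 := integral_map (μ := S.weight.completion) hp.measurable.aemeasurable
      (f := fun x => (starRingEnd 𝕜) (S.eval f x) * S.eval g x)
      (by rw [hp.map_eq]; exact hi.aestronglyMeasurable)
    rw [hp.map_eq] at h2
    exact h2.symm
  rw [h1, L2.inner_def]
  refine integral_congr_ae ?_
  filter_upwards [(S.memLp f).coeFn_toLp, (S.memLp g).coeFn_toLp] with x hf hg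
  rw [RCLike.inner_apply, mul_comm]
  change (starRingEnd 𝕜) ((S.memLp f).toLp (S.eval f) x) * (S.memLp g).toLp (S.eval g) x = _
  rw [hf, hg]

theorem norm_app_sq (f : S.F) : ‖S.app f‖ ^ 2 = ∫ x, ‖S.evalPoints f x‖ ^ 2 ∂S.weight.completion := by
  have h := S.inner_app f f
  rw [inner_self_eq_norm_sq_to_K, l2Inner_self] at h
  exact_mod_cast h

/-- The functional `f ↦ f(x)`. -/
def pointEval (x : S.D) : S.F →ₗ[𝕜] 𝕜 := LinearMap.proj x ∘ₗ S.eval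

theorem pointEval_mem (x : S.D) : S.pointEval x ∈ S.stdInfo := ⟨x, fun _ => rfl⟩

end ApproxProblem

namespace SampleScheme

variable {𝕜 : Type} [RCLike 𝕜] {d : ℕ} {S : ApproxProblem 𝕜 d} {N : ℕ}

/-- Extension of a finite sequence by zero. -/
def extendZero {n : ℕ} (y : Fin n → 𝕜) (l : ℕ) : 𝕜 := if h : l < n then y ⟨l, h⟩ else 0

theorem measurable_extendZero {n : ℕ} : Measurable (extendZero : (Fin n → 𝕜) → ℕ → 𝕜) := by
  refine measurable_pi_lambda _ fun l => ?_
  unfold extendZero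
  by_cases h : l < n
  · simp only [h, dif_pos]
    exact measurable_pi_apply _
  · simp only [h, dif_neg, not_false_eq_true]
    exact measurable_const

theorem coef_extendZero (s : SampleScheme 𝕜 S.Points N) (f : S.F) (ω : s.Ω) :
    s.coef ω (extendZero fun j : Fin s.n => S.pointEval (s.pts ω j) f) =
      s.estimate (S.evalPoints f) ω := by
  refine s.coef_congr _ _ _ fun l hl => ?_
  simp only [extendZero, hl, dif_pos]
  rfl

/-- The randomized algorithm that estimates the coefficients with respect to `w`. -/
def toRandAlg (s : SampleScheme 𝕜 S.Points N) (w : Fin N → S.F) :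
    S.RandAlg S.stdInfo where
  Ω := s.Ω
  P := s.P
  L ω j := S.pointEval (s.pts ω j)
  L_mem ω j := S.pointEval_mem _
  card _ _ := s.n
  card_adaptive _ _ _ _ := rfl
  φ ω n y := ∑ j, s.coef ω (extendZero y) j • S.app (w j)
  measurable_φ ω n := by
    refine Finset.stronglyMeasurable_fun_sum _ fun j _ => StronglyMeasurable.smul_const ?_ _
    refine Measurable.stronglyMeasurable ?_
    exact (s.measurable_coef j).comp (measurable_const.prodMk measurable_extendZero)
  measurable_card k v := measurable_const
  measurable_out k v := by
    refine Finset.stronglyMeasurable_fun_sum _ fun j _ => StronglyMeasurable.smul_const ?_ _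
    refine Measurable.stronglyMeasurable ?_
    have hy : Measurable fun q : (Fin k → 𝕜) × s.Ω => fun l : Fin s.n =>
        S.pointEval (s.pts q.2 l) (∑ i, q.1 i • v i) := by
      refine measurable_pi_lambda _ fun l => ?_
      simp only [map_sum, map_smul, smul_eq_mul]
      refine Finset.measurable_fun_sum _ fun i _ =>
        ((measurable_pi_apply i).comp measurable_fst).mul ?_
      exact (S.measurable_evalPoints (v i)).comp ((s.measurable_pts l).comp measurable_snd)
    exact (s.measurable_coef j).comp (measurable_snd.prodMk (measurable_extendZero.comp hy))

theorem cardinality_toRandAlg_le (s : SampleScheme 𝕜 S.Points N) (w : Fin N → S.F) :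
    (s.toRandAlg w).cardinality ≤ s.n := by
  refine iSup₂_le fun f _ => ?_
  change ∫⁻ _ : s.Ω, (s.n : ℝ≥0∞) ∂s.P ≤ s.n
  simp

theorem isL2Orthonormal_evalPoints {w : Fin N → S.F} (hw : Orthonormal 𝕜 fun i => S.app (w i)) :
    IsL2Orthonormal S.weight.completion fun i => S.evalPoints (w i) where
  measurable i := S.measurable_evalPoints _
  memLp i := S.memLp_evalPoints _
  inner_eq i j := by
    rw [← S.inner_app]
    exact orthonormal_iff_ite.1 hw i j

/-- The error splits orthogonally into the distance `g` to the span, with `‖g‖ ≤ σ`, and the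
coefficient error, whose mean square is at most `B ‖g‖²`. -/
theorem error_toRandAlg_le (s : SampleScheme 𝕜 S.Points N) {w : Fin N → S.F}
    (hw : Orthonormal 𝕜 fun i => S.app (w i)) {σ B : ℝ} (hB : 0 ≤ B)
    (happ : ∀ f, ‖S.app f - ∑ i, inner 𝕜 (S.app (w i)) (S.app f) • S.app (w i)‖ ^ 2 ≤
      σ ^ 2 * ‖f‖ ^ 2)
    (hs : s.HasVariance S.weight.completion (fun i => S.evalPoints (w i)) B) :
    (s.toRandAlg w).error ≤ ENNReal.ofReal (σ ^ 2 * (1 + B)) ^ (1 / 2 : ℝ) := by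
  refine iSup₂_le fun f hf => ENNReal.rpow_le_rpow ?_ (by norm_num)
  let g := S.app f - ∑ i, inner 𝕜 (S.app (w i)) (S.app f) • S.app (w i)
  have hgσ : ‖g‖ ^ 2 ≤ σ ^ 2 := by
    refine (happ f).trans ?_
    have : ‖f‖ ^ 2 ≤ 1 := pow_le_one₀ (norm_nonneg _) hf
    nlinarith [sq_nonneg σ]
  have hgw : ∀ j, inner 𝕜 g (S.app (w j)) = 0 := fun j => by
    have h1 : inner 𝕜 (S.app (w j)) g = 0 := by
      simp only [g]
      rw [inner_sub_right, hw.inner_right_fintype, sub_self]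
    rw [← inner_conj_symm, h1, map_zero]
  have hres : ∫ x, ‖residual S.weight.completion (fun i => S.evalPoints (w i)) (S.evalPoints f) x‖ ^ 2
      ∂S.weight.completion = ‖g‖ ^ 2 := by
    have h1 : g = S.app (f - ∑ i, inner 𝕜 (S.app (w i)) (S.app f) • w i) := by
      change _ = S.appL _
      simp only [g, map_sub, map_sum, map_smul]
      rfl
    rw [h1, S.norm_app_sq]
    congr 1
    ext x
    simp only [residual, ApproxProblem.inner_app, S.evalPoints_sub_sum]
  have hnorm : ∀ ω : s.Ω, ‖S.app f - ∑ j, s.estimate (S.evalPoints f) ω j • S.app (w j)‖ₑ ^ 2 =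
      ENNReal.ofReal (‖g‖ ^ 2) +
      ENNReal.ofReal (∑ j, ‖l2Inner S.weight.completion (S.evalPoints (w j)) (S.evalPoints f) -
        s.estimate (S.evalPoints f) ω j‖ ^ 2) := by
    intro ω
    rw [← ofReal_norm, ← ENNReal.ofReal_pow (norm_nonneg _),
      ← ENNReal.ofReal_add (by positivity) (Finset.sum_nonneg fun j _ => by positivity)]
    congr 1
    simp only [← ApproxProblem.inner_app]
    have h1 : S.app f - ∑ j, s.estimate (S.evalPoints f) ω j • S.app (w j) =
        g + ∑ j, (inner 𝕜 (S.app (w j)) (S.app f) - s.estimate (S.evalPoints f) ω j) •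
          S.app (w j) := by
      simp only [g, sub_smul, Finset.sum_sub_distrib]
      abel
    have h2 : inner 𝕜 g (∑ j, (inner 𝕜 (S.app (w j)) (S.app f) -
        s.estimate (S.evalPoints f) ω j) • S.app (w j)) = 0 := by
      rw [inner_sum]
      refine Finset.sum_eq_zero fun j _ => ?_
      rw [inner_smul_right, hgw, mul_zero]
    have h3 := norm_add_sq_eq_norm_sq_add_norm_sq_of_inner_eq_zero _ _ h2
    rw [h1, pow_two, h3, pow_two]
    congr 1
    rw [← pow_two, ← inner_self_eq_norm_sq (𝕜 := 𝕜), hw.inner_sum, map_sum]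
    refine Finset.sum_congr rfl fun j _ => ?_
    rw [RCLike.conj_mul]
    norm_cast
  have hv := hs _ (S.measurable_evalPoints f) (S.memLp_evalPoints f)
  rw [hres] at hv
  change ∫⁻ ω : s.Ω, ‖S.app f - ∑ j, s.coef ω
    (extendZero fun l : Fin s.n => S.pointEval (s.pts ω l) f) j • S.app (w j)‖ₑ ^ 2 ∂s.P ≤ _
  simp only [coef_extendZero, hnorm]
  rw [lintegral_add_left measurable_const, lintegral_const, measure_univ, mul_one]
  refine (add_le_add_right hv _).trans ?_
  rw [← ENNReal.ofReal_add (by positivity) (by positivity)]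
  refine ENNReal.ofReal_le_ofReal ?_
  nlinarith

/-- The estimate of no coefficients. -/
theorem exists_trivial (S : ApproxProblem 𝕜 d) (μ : Measure S.Points) (u : Fin 0 → S.Points → 𝕜) :
    ∃ s : SampleScheme 𝕜 S.Points 0, s.n = 0 ∧ s.HasVariance μ u 0 := by
  obtain ⟨x⟩ := S.nonempty_D
  exact ⟨{
    Ω := Unit
    P := Measure.dirac ()
    n := 0
    pts := fun _ _ => x
    measurable_pts := fun _ => measurable_const
    coef := fun _ _ => 0
    measurable_coef := fun _ => measurable_const
    coef_congr := fun _ _ _ _ => rfl }, rfl, fun f _ _ => by simp⟩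

end SampleScheme

/-! ### Comparison of the two information complexities. -/

namespace ApproxProblem

variable {𝕜 : Type} [RCLike 𝕜] {d : ℕ} {S : ApproxProblem 𝕜 d} {Λ : Set (S.F →ₗ[𝕜] 𝕜)}

theorem minError_antitone : Antitone (S.minError Λ) := fun n k hnk =>
  le_iInf₂ fun A hA => iInf₂_le A (hA.trans (by exact_mod_cast hnk))

theorem minError_le (A : RandAlg S Λ) {n : ℕ} (hA : A.cardinality ≤ n) : S.minError Λ n ≤ A.error :=
  iInf₂_le A hA

theorem infoComplexity_le {n : ℕ} {ε : ℝ} (h : S.minError Λ n ≤ ENNReal.ofReal ε) :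
    S.infoComplexity Λ ε ≤ n := iInf₂_le n h

theorem minError_le_of_infoComplexity_eq {n : ℕ} {ε : ℝ} (h : S.infoComplexity Λ ε = n) :
    S.minError Λ n ≤ ENNReal.ofReal ε := by
  by_contra hn
  have h1 : ((n + 1 : ℕ) : ℕ∞) ≤ S.infoComplexity Λ ε := by
    refine le_iInf₂ fun k hk => ?_
    have : n < k := by
      by_contra! hkn
      exact hn ((minError_antitone hkn).trans hk)
    exact_mod_cast this
  rw [h] at h1
  exact absurd (Nat.cast_le.1 h1) (by omega)

/-- An algorithm also uses every larger class of functionals. -/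
def RandAlg.mono {Λ' : Set (S.F →ₗ[𝕜] 𝕜)} (A : RandAlg S Λ) (h : Λ ⊆ Λ') : RandAlg S Λ' :=
  { A with L_mem := fun ω j => h (A.L_mem ω j) }

theorem infoComplexity_mono {Λ' : Set (S.F →ₗ[𝕜] 𝕜)} (h : Λ ⊆ Λ') (ε : ℝ) :
    S.infoComplexity Λ' ε ≤ S.infoComplexity Λ ε := by
  refine le_iInf₂ fun n hn => infoComplexity_le (le_trans ?_ hn)
  exact le_iInf₂ fun A hA => minError_le (A.mono h) hA

/-- The spectral consequence of the lower bound: if `n` functionals suffice for the error `ε`, then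
the embedding is up to a slightly larger error an operator of rank at most `n M²`. -/
theorem exists_orthonormal_of_minError_le {n M : ℕ} {ε' ε σ : ℝ} (hε' : ε' < ε) (hε0 : 0 < ε)
    (hσ : 0 < σ) (hM : 0 < M) (hσM : ε ^ 2 < σ ^ 2 * (1 - 2 / M))
    (h : S.minError Λ n ≤ ENNReal.ofReal ε') :
    ∃ N ≤ n * M ^ 2, ∃ w : Fin N → S.F, Orthonormal 𝕜 (fun i => S.app (w i)) ∧
      ∀ f, ‖S.app f - ∑ i, inner 𝕜 (S.app (w i)) (S.app f) • S.app (w i)‖ ^ 2 ≤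
        σ ^ 2 * ‖f‖ ^ 2 := by
  -- The infimum over algorithms need not be attained; the gap between `ε'` and `ε` provides an
  -- actual algorithm.
  have hlt : S.minError Λ n < ENNReal.ofReal ε :=
    h.trans_lt ((ENNReal.ofReal_lt_ofReal_iff hε0).2 hε')
  obtain ⟨A, hA⟩ := iInf_lt_iff.1 hlt
  obtain ⟨hAn, hAε⟩ := iInf_lt_iff.1 hA
  have hMR : (0 : ℝ) < M := by exact_mod_cast hM
  obtain ⟨N, hN, w, hw⟩ := exists_orthonormal_approximation S.isCompactOperator_appL hσ
    (m := n * M ^ 2 + 1) (by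
      intro v hv hbd
      -- With `K = nM` and `m = nM² + 1`, both losses `K/m` and `n/(K+1)` are at most `1/M`, which
      -- contradicts `hσM`. For `n = 0` this still makes sense, with `m = 1`.
      have h1 := A.le_error_sq hAn (n * M) (Nat.succ_pos _) hv hbd
      have h2 : A.error ^ 2 ≤ ENNReal.ofReal (ε ^ 2) := by
        rw [ENNReal.ofReal_pow hε0.le]
        exact pow_le_pow_left' hAε.le 2
      have h3 : ((n * M : ℕ) : ℝ≥0∞) * ((n * M ^ 2 + 1 : ℕ) : ℝ≥0∞)⁻¹ + n / ((n * M + 1 : ℕ) : ℝ≥0∞) =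
          ENNReal.ofReal ((n * M : ℕ) / (n * M ^ 2 + 1 : ℕ) + n / (n * M + 1 : ℕ)) := by
        rw [ENNReal.ofReal_add (by positivity) (by positivity),
          ENNReal.ofReal_div_of_pos (by positivity), ENNReal.ofReal_div_of_pos (by positivity)]
        simp only [ENNReal.ofReal_natCast, div_eq_mul_inv]
      rw [h3, ← ENNReal.ofReal_mul (by positivity)] at h1
      have h4 := h1.trans (add_le_add_left h2 _)
      rw [← ENNReal.ofReal_add (by positivity) (by positivity),
        ENNReal.ofReal_le_ofReal_iff (by positivity)] at h4
      have h5 : ((n * M : ℕ) : ℝ) / (n * M ^ 2 + 1 : ℕ) ≤ 1 / M := by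
        rw [div_le_div_iff₀ (by positivity) hMR]
        push_cast
        nlinarith
      have h6 : (n : ℝ) / (n * M + 1 : ℕ) ≤ 1 / M := by
        rw [div_le_div_iff₀ (by positivity) hMR]
        push_cast
        nlinarith
      have h7 : (2 : ℝ) / M = 1 / M + 1 / M := by ring
      have h8 : σ ^ 2 * (((n * M : ℕ) : ℝ) / (n * M ^ 2 + 1 : ℕ) + n / (n * M + 1 : ℕ)) ≤
          σ ^ 2 * (2 / M) := by
        rw [h7]
        gcongr
      linarith)
  exact ⟨N, by omega, w, hw⟩

end ApproxProblem

/-- With `x = N/a` and `T = ⌈x log x⌉`, the bound `1 - t ≤ exp(-t)` gives `(1 - a/N)^T ≤ 1/x`, and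
`log x ≤ x^η/η` turns the logarithm into a small power. -/
theorem exists_sample_count {η : ℝ} (hη : 0 < η) {a : ℝ} (ha : 0 < a) (ha1 : a ≤ 1) {N : ℕ}
    (hN : 0 < N) : ∃ T : ℕ, (1 - a / N) ^ T * N ≤ a ∧
      ((N + T : ℕ) : ℝ) ≤ (2 + 1 / η) * (N / a) ^ (1 + η) := by
  have hN' : (1 : ℝ) ≤ N := by exact_mod_cast hN
  set x : ℝ := N / a with hx
  have hx1 : 1 ≤ x := by
    rw [hx, le_div_iff₀ ha]
    linarith
  have hx0 : 0 < x := by linarith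
  have hNx : (N : ℝ) ≤ x := by
    rw [hx, le_div_iff₀ ha]
    nlinarith
  have hlog : 0 ≤ Real.log x := Real.log_nonneg hx1
  refine ⟨⌈x * Real.log x⌉₊, ?_, ?_⟩
  · have h1 : 1 - a / N ≤ Real.exp (-(a / N)) := by
      have := Real.add_one_le_exp (-(a / (N : ℝ)))
      linarith
    have h0 : 0 ≤ 1 - a / N := by
      rw [sub_nonneg, div_le_one (by positivity)]
      linarith
    have h2 : x * Real.log x ≤ (⌈x * Real.log x⌉₊ : ℝ) := Nat.le_ceil _
    have h3 : (1 - a / N) ^ ⌈x * Real.log x⌉₊ ≤ Real.exp (-Real.log x) := by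
      refine (pow_le_pow_left₀ h0 h1 _).trans ?_
      rw [← Real.exp_nat_mul]
      refine Real.exp_le_exp.2 ?_
      have h4 : Real.log x = a / N * (x * Real.log x) := by
        rw [hx]
        field_simp
      rw [mul_neg, neg_le_neg_iff]
      conv_lhs => rw [h4]
      rw [mul_comm]
      gcongr
    rw [Real.exp_neg, Real.exp_log hx0] at h3
    calc _ ≤ x⁻¹ * N := by gcongr
      _ = a := by
        rw [hx]
        field_simp
  · have h1 : (⌈x * Real.log x⌉₊ : ℝ) ≤ x * Real.log x + 1 :=
      (Nat.ceil_lt_add_one (by positivity)).le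
    have h2 : Real.log x ≤ x ^ η / η := Real.log_le_rpow_div hx0.le hη
    have h3 : (1 : ℝ) ≤ x ^ η := Real.one_le_rpow hx1 hη.le
    have h4 : x ^ (1 + η) = x * x ^ η := by rw [Real.rpow_add hx0, Real.rpow_one]
    rw [h4]
    push_cast
    have h5 : x * Real.log x ≤ x * (x ^ η / η) := by gcongr
    have h6 : (2 + 1 / η) * (x * x ^ η) = x * x ^ η + x * x ^ η + x * (x ^ η / η) := by ring
    rw [h6]
    have h7 : x ≤ x * x ^ η := le_mul_of_one_le_right hx0.le h3
    linarith

namespace ApproxProblem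

variable {𝕜 : Type} [RCLike 𝕜] {d : ℕ}

theorem minError_stdInfo_le (S : ApproxProblem 𝕜 d) {N : ℕ} (s : SampleScheme 𝕜 S.Points N)
    {w : Fin N → S.F} (hw : Orthonormal 𝕜 fun i => S.app (w i)) {σ B ε : ℝ} (hB : 0 ≤ B)
    (happ : ∀ f, ‖S.app f - ∑ i, inner 𝕜 (S.app (w i)) (S.app f) • S.app (w i)‖ ^ 2 ≤
      σ ^ 2 * ‖f‖ ^ 2)
    (hs : s.HasVariance S.weight.completion (fun i => S.evalPoints (w i)) B) (hε : 0 ≤ ε)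
    (hσε : σ ^ 2 * (1 + B) ≤ ε ^ 2) : S.minError S.stdInfo s.n ≤ ENNReal.ofReal ε := by
  refine (minError_le _ (s.cardinality_toRandAlg_le w)).trans
    ((s.error_toRandAlg_le hw hB happ hs).trans ?_)
  calc _ ≤ ENNReal.ofReal (ε ^ 2) ^ (1 / 2 : ℝ) := by gcongr
    _ = ENNReal.ofReal ε := by
      rw [ENNReal.ofReal_pow hε, ← ENNReal.rpow_natCast, ← ENNReal.rpow_mul]
      norm_num

/-- Function values are almost as powerful as arbitrary linear functionals. -/
theorem exists_infoComplexity_stdInfo_le {η : ℝ} (hη : 0 < η) (hη1 : η ≤ 1) :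
    ∃ C : ℝ, 1 ≤ C ∧ ∀ {𝕜 : Type} [RCLike 𝕜] {d : ℕ} (S : ApproxProblem 𝕜 d) {ε : ℝ}, 0 < ε →
      ∀ n : ℕ, S.infoComplexity S.allInfo (ε / (1 + η)) = n →
        ∃ k : ℕ, S.infoComplexity S.stdInfo ε = k ∧ (k : ℝ) ≤ C * (n : ℝ) ^ (1 + η) := by
  -- The slack from `δ = ε/(1+η)` to `ε` is spent in three stages: `δ(1+η/4)` for an unattained
  -- infimum, `σ = δ(1+η/2)` for the loss `2/M < η/6`, and finally the variance factor `B ≤ 2a =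
  -- η/4`.
  obtain ⟨M, hM⟩ := exists_nat_gt (12 / η)
  have hMR : (0 : ℝ) < M := lt_trans (by positivity) hM
  have hM0 : 0 < M := by exact_mod_cast hMR
  have hM1 : (1 : ℝ) ≤ M := by exact_mod_cast hM0
  set a : ℝ := η / 8 with ha
  have ha0 : 0 < a := by positivity
  have ha1 : a ≤ 1 := by rw [ha]; linarith
  have hbase : 1 ≤ (M : ℝ) ^ 2 / a := by
    rw [le_div_iff₀ ha0]
    nlinarith
  refine ⟨(2 + 1 / η) * ((M : ℝ) ^ 2 / a) ^ (1 + η), ?_, ?_⟩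
  · have h1 : (1 : ℝ) ≤ ((M : ℝ) ^ 2 / a) ^ (1 + η) := Real.one_le_rpow hbase (by positivity)
    have h2 : (0 : ℝ) < 1 / η := by positivity
    nlinarith
  intro 𝕜 _ d S ε hε n hn
  set δ := ε / (1 + η) with hδ
  have hδ0 : 0 < δ := by positivity
  have hεδ : ε = δ * (1 + η) := by
    rw [hδ]
    field_simp
  have hσM : (δ * (1 + η / 4)) ^ 2 < (δ * (1 + η / 2)) ^ 2 * (1 - 2 / M) := by
    have h1 : 2 / (M : ℝ) < η / 6 := by
      rw [div_lt_iff₀ hMR]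
      rw [div_lt_iff₀ hη] at hM
      linarith
    rw [mul_pow, mul_pow, mul_assoc]
    refine mul_lt_mul_of_pos_left ?_ (by positivity)
    have h2 : (1 + η / 4) ^ 2 ≤ (1 + η / 2) ^ 2 * (1 - η / 6) := by nlinarith [sq_nonneg η]
    refine h2.trans_lt (mul_lt_mul_of_pos_left (by linarith) (by positivity))
  obtain ⟨N, hN, w, hw, happ⟩ := exists_orthonormal_of_minError_le (ε := δ * (1 + η / 4))
    (σ := δ * (1 + η / 2)) (by nlinarith) (by positivity) (by positivity) hM0 hσM
    (minError_le_of_infoComplexity_eq hn)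
  have key : ∃ k : ℕ, S.infoComplexity S.stdInfo ε ≤ k ∧
      (k : ℝ) ≤ (2 + 1 / η) * ((M : ℝ) ^ 2 / a) ^ (1 + η) * (n : ℝ) ^ (1 + η) := by
    -- If `n = 0` then `N = 0`, and no sample at all may be used because the claimed bound is then
    -- zero. This removes any condition on the initial error.
    rcases Nat.eq_zero_or_pos N with rfl | hN0
    · obtain ⟨s, hs, hv⟩ := SampleScheme.exists_trivial S S.weight.completion
        fun i => S.evalPoints (w i)
      refine ⟨0, infoComplexity_le ?_, by simp only [Nat.cast_zero]; positivity⟩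
      rw [← hs]
      refine S.minError_stdInfo_le s hw le_rfl happ hv hε.le ?_
      rw [hεδ, add_zero, mul_one]
      gcongr
      linarith
    · obtain ⟨T, hT, hNT⟩ := exists_sample_count hη ha0 ha1 hN0
      obtain ⟨s, hs, hv⟩ := SampleScheme.exists_hasVariance
        (SampleScheme.isL2Orthonormal_evalPoints hw) hN0 ha0 ha1 T
      refine ⟨N + T, infoComplexity_le ?_, ?_⟩
      · rw [← hs]
        have hNR : (1 : ℝ) ≤ N := by exact_mod_cast hN0
        have h0 : 0 ≤ 1 - a / N := by
          rw [sub_nonneg, div_le_one (by positivity)]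
          linarith
        refine S.minError_stdInfo_le s hw (by positivity) happ hv hε.le ?_
        rw [hεδ, mul_pow, mul_pow, mul_assoc]
        refine mul_le_mul_of_nonneg_left ?_ (by positivity)
        have h1 : 1 + (a + (1 - a / N) ^ T * N) ≤ 1 + η / 4 := by
          rw [ha] at hT ⊢
          linarith
        calc _ ≤ (1 + η / 2) ^ 2 * (1 + η / 4) := by gcongr
          _ ≤ (1 + η) ^ 2 := by nlinarith [sq_nonneg η]
      · refine hNT.trans ?_
        rw [mul_assoc, ← Real.mul_rpow (by positivity) (by positivity)]
        gcongr
        rw [div_mul_eq_mul_div, mul_comm]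
        gcongr
        exact_mod_cast hN
  obtain ⟨k, hk, hkn⟩ := key
  obtain ⟨j, hj⟩ := ENat.ne_top_iff_exists.1 (ne_top_of_le_ne_top (ENat.natCast_ne_top k) hk)
  refine ⟨j, hj.symm, le_trans ?_ hkn⟩
  rw [← hj] at hk
  exact_mod_cast hk

end ApproxProblem

/-! ### Stability of the tractability notions. -/

section Tractability

theorem toENNReal_le_ofReal_iff {x : ℕ∞} {r : ℝ} (hr : 0 ≤ r) :
    (x : ℝ≥0∞) ≤ ENNReal.ofReal r ↔ ∃ n : ℕ, x = n ∧ (n : ℝ) ≤ r := by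
  constructor
  · intro h
    have hx : x ≠ ⊤ := by
      rintro rfl
      simp at h
    obtain ⟨n, rfl⟩ := ENat.ne_top_iff_exists.1 hx
    refine ⟨n, rfl, ?_⟩
    rw [ENat.toENNReal_coe, ← ENNReal.ofReal_natCast] at h
    exact (ENNReal.ofReal_le_ofReal_iff hr).1 h
  · rintro ⟨n, rfl, h⟩
    rw [ENat.toENNReal_coe, ← ENNReal.ofReal_natCast]
    exact ENNReal.ofReal_le_ofReal h

/-- `N'` is at least `N`, and it is almost bounded by `N` at a slightly smaller error. -/
structure AlmostEquivalent (N N' : ℕ+ → ℝ → ℕ∞) : Prop where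
  le : ∀ d ε, N d ε ≤ N' d ε
  exists_le : ∀ η : ℝ, 0 < η → η ≤ 1 → ∃ C : ℝ, 1 ≤ C ∧ ∀ d ε, 0 < ε → ∀ n : ℕ,
    N d (ε / (1 + η)) = n → ∃ k : ℕ, N' d ε = k ∧ (k : ℝ) ≤ C * (n : ℝ) ^ (1 + η)

variable {N N' : ℕ+ → ℝ → ℕ∞}

theorem div_one_add_mem_Ioo {ε η : ℝ} (hη : 0 < η) (hε : ε ∈ Ioo (0 : ℝ) 1) :
    ε / (1 + η) ∈ Ioo (0 : ℝ) 1 := by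
  refine ⟨div_pos hε.1 (by positivity), ?_⟩
  rw [div_lt_one (by positivity)]
  linarith [hε.2]

theorem AlgSPTWith.mono (h : ∀ d ε, N d ε ≤ N' d ε) {p : ℝ≥0} (hp : AlgSPTWith N' p) :
    AlgSPTWith N p := by
  obtain ⟨C, hC, hb⟩ := hp
  exact ⟨C, hC, fun d ε hε => le_trans (ENat.toENNReal_mono (h d ε)) (hb d ε hε)⟩

theorem AlgQPTWith.mono (h : ∀ d ε, N d ε ≤ N' d ε) {t : ℝ≥0} (ht : AlgQPTWith N' t) :
    AlgQPTWith N t := by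
  obtain ⟨C, hC, hb⟩ := ht
  exact ⟨C, hC, fun d ε hε => le_trans (ENat.toENNReal_mono (h d ε)) (hb d ε hε)⟩

theorem AlgPT.mono (h : ∀ d ε, N d ε ≤ N' d ε) (hp : AlgPT N') : AlgPT N := by
  obtain ⟨C, hC, p, q, hb⟩ := hp
  exact ⟨C, hC, p, q, fun d ε hε => le_trans (ENat.toENNReal_mono (h d ε)) (hb d ε hε)⟩

theorem AlmostEquivalent.algSPTWith (h : AlmostEquivalent N N') {p : ℝ≥0} (hp : AlgSPTWith N p)
    {η : ℝ≥0} (hη : 0 < η) (hη1 : η ≤ 1) : AlgSPTWith N' (p * (1 + η)) := by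
  obtain ⟨C, hC, hb⟩ := hp
  have hη' : (0 : ℝ) < η := hη
  obtain ⟨K, hK, hk⟩ := h.exists_le η hη' (by exact_mod_cast hη1)
  refine ⟨K * (C * (1 + η) ^ (p : ℝ)) ^ (1 + η : ℝ), by positivity, fun d ε hε => ?_⟩
  have hε' := div_one_add_mem_Ioo hη' hε
  have hε0 := hε.1
  obtain ⟨n, hn, hnb⟩ := (toENNReal_le_ofReal_iff
    (mul_nonneg hC.le (Real.rpow_nonneg hε'.1.le _))).1 (hb d _ hε')
  obtain ⟨k, hkn, hkb⟩ := hk d ε hε.1 n hn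
  refine (toENNReal_le_ofReal_iff (by positivity)).2 ⟨k, hkn, hkb.trans ?_⟩
  rw [mul_assoc]
  gcongr
  calc (n : ℝ) ^ (1 + η : ℝ) ≤ (C * (ε / (1 + η)) ^ (-(p : ℝ))) ^ (1 + η : ℝ) := by gcongr
    _ = ((C * (1 + η) ^ (p : ℝ)) * ε ^ (-(p : ℝ))) ^ (1 + η : ℝ) := by
      congr 1
      rw [Real.div_rpow hε0.le (by positivity), Real.rpow_neg (by positivity : (0 : ℝ) ≤ 1 + η)]
      field_simp
    _ = (C * (1 + η) ^ (p : ℝ)) ^ (1 + η : ℝ) * ε ^ (-((p * (1 + η) : ℝ≥0) : ℝ)) := by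
      rw [Real.mul_rpow (by positivity) (by positivity), ← Real.rpow_mul hε0.le]
      push_cast
      ring_nf

/-- No exponent has to be preserved, so the choice `η = 1` suffices. -/
theorem AlmostEquivalent.algPT (h : AlmostEquivalent N N') (hp : AlgPT N) : AlgPT N' := by
  obtain ⟨C, hC, p, q, hb⟩ := hp
  obtain ⟨K, hK, hk⟩ := h.exists_le 1 one_pos le_rfl
  refine ⟨K * (C * 2 ^ (p : ℝ)) ^ (2 : ℝ), by positivity, p * 2, q * 2, fun d ε hε => ?_⟩
  have hε' := div_one_add_mem_Ioo one_pos hε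
  have hε0 := hε.1
  have hε'0 := hε'.1
  obtain ⟨n, hn, hnb⟩ := (toENNReal_le_ofReal_iff (by positivity)).1 (hb d _ hε')
  obtain ⟨k, hkn, hkb⟩ := hk d ε hε.1 n hn
  refine (toENNReal_le_ofReal_iff (by positivity)).2 ⟨k, hkn, hkb.trans ?_⟩
  rw [one_add_one_eq_two] at hnb ⊢
  rw [mul_assoc, mul_assoc]
  gcongr
  calc (n : ℝ) ^ (2 : ℝ) ≤ (C * ((d : ℕ) : ℝ) ^ (q : ℝ) * (ε / 2) ^ (-(p : ℝ))) ^ (2 : ℝ) := by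
        gcongr
    _ = ((C * 2 ^ (p : ℝ)) * (((d : ℕ) : ℝ) ^ (q : ℝ) * ε ^ (-(p : ℝ)))) ^ (2 : ℝ) := by
      congr 1
      rw [Real.div_rpow hε0.le zero_le_two, Real.rpow_neg (zero_le_two : (0 : ℝ) ≤ 2)]
      field_simp
    _ = (C * 2 ^ (p : ℝ)) ^ (2 : ℝ) *
        (((d : ℕ) : ℝ) ^ ((q * 2 : ℝ≥0) : ℝ) * ε ^ (-((p * 2 : ℝ≥0) : ℝ))) := by
      have hd0 : (0 : ℝ) ≤ (d : ℕ) := Nat.cast_nonneg _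
      rw [Real.mul_rpow (x := C * 2 ^ (p : ℝ)) (by positivity) (by positivity),
        Real.mul_rpow (x := ((d : ℕ) : ℝ) ^ (q : ℝ)) (by positivity) (by positivity),
        ← Real.rpow_mul hε0.le, ← Real.rpow_mul hd0]
      push_cast
      ring_nf

theorem AlmostEquivalent.algQPTWith (h : AlmostEquivalent N N') {t : ℝ≥0} (ht : AlgQPTWith N t)
    {η : ℝ≥0} (hη : 0 < η) (hη1 : η ≤ 1) : AlgQPTWith N' (t * (1 + η)) := by
  obtain ⟨C, hC, hb⟩ := ht
  have hη' : (0 : ℝ) < η := hη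
  have hη1' : (η : ℝ) ≤ 1 := by exact_mod_cast hη1
  -- The exponent loses a factor `1+θ` twice, from the power of `n` and from the shift of `ε`; for
  -- `η ≤ 1` this choice gives `(1+θ)² ≤ 1+η`.
  set θ : ℝ := η / 3 with hθ
  have hθ0 : 0 < θ := by positivity
  obtain ⟨K, hK, hk⟩ := h.exists_le θ hθ0 (by rw [hθ]; linarith)
  refine ⟨K * C ^ (1 + θ), by positivity, fun d ε hε => ?_⟩
  have hε' := div_one_add_mem_Ioo hθ0 hε
  have hε0 := hε.1
  obtain ⟨n, hn, hnb⟩ := (toENNReal_le_ofReal_iff (by positivity)).1 (hb d _ hε')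
  obtain ⟨k, hkn, hkb⟩ := hk d ε hε.1 n hn
  refine (toENNReal_le_ofReal_iff (by positivity)).2 ⟨k, hkn, hkb.trans ?_⟩
  rw [mul_assoc]
  gcongr
  refine (Real.rpow_le_rpow (by positivity) hnb (by positivity)).trans ?_
  rw [Real.mul_rpow hC.le (by positivity), ← Real.exp_mul]
  refine mul_le_mul_of_nonneg_left (Real.exp_le_exp.2 ?_) (by positivity)
  have hd : 0 ≤ Real.log ((d : ℕ) : ℝ) := Real.log_natCast_nonneg _
  have hle : 0 ≤ Real.log ε⁻¹ := Real.log_nonneg ((one_le_inv₀ hε0).2 hε.2.le)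
  have h1 : Real.log (ε / (1 + θ))⁻¹ ≤ θ + Real.log ε⁻¹ := by
    rw [inv_div, div_eq_mul_inv, Real.log_mul (by positivity) (by positivity)]
    have := Real.log_le_sub_one_of_pos (by positivity : 0 < 1 + θ)
    linarith
  have h2 : (1 + Real.log (ε / (1 + θ))⁻¹) * (1 + θ) ≤ (1 + η) * (1 + Real.log ε⁻¹) := by
    calc _ ≤ (1 + (θ + Real.log ε⁻¹)) * (1 + θ) := by gcongr
      _ ≤ ((1 + θ) * (1 + Real.log ε⁻¹)) * (1 + θ) := by
        gcongr
        nlinarith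
      _ = (1 + θ) ^ 2 * (1 + Real.log ε⁻¹) := by ring
      _ ≤ _ := by
        gcongr
        rw [hθ]
        nlinarith
  push_cast
  calc _ = t * (1 + Real.log ((d : ℕ) : ℝ)) * ((1 + Real.log (ε / (1 + θ))⁻¹) * (1 + θ)) := by ring
    _ ≤ t * (1 + Real.log ((d : ℕ) : ℝ)) * ((1 + η) * (1 + Real.log ε⁻¹)) := by gcongr
    _ = _ := by ring

theorem iInf_exponent_eq {P P' : ℝ≥0 → Prop} (h : ∀ p, P' p → P p)
    (h' : ∀ p, P p → ∀ η : ℝ≥0, 0 < η → η ≤ 1 → P' (p * (1 + η))) :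
    ⨅ (p : ℝ≥0) (_ : P p), (p : ℝ≥0∞) = ⨅ (p : ℝ≥0) (_ : P' p), (p : ℝ≥0∞) := by
  refine le_antisymm (le_iInf₂ fun p hp => iInf₂_le p (h p hp)) (le_iInf₂ fun p hp => ?_)
  refine ENNReal.le_of_forall_pos_le_add fun δ hδ _ => ?_
  -- Chosen so that `p η ≤ δ`; the `+ 1` covers `p = 0`.
  have hη : 0 < min 1 (δ / (p + 1)) := lt_min one_pos (by positivity)
  refine (iInf₂_le _ (h' p hp _ hη (min_le_left _ _))).trans ?_
  rw [← ENNReal.coe_add, ENNReal.coe_le_coe, mul_add, mul_one]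
  gcongr
  calc p * min 1 (δ / (p + 1)) ≤ (p + 1) * (δ / (p + 1)) := by
        gcongr
        · exact le_self_add
        · exact min_le_right _ _
    _ = δ := by field_simp

theorem log_natCast_mono {m n : ℕ} (h : m ≤ n) : Real.log m ≤ Real.log n := by
  rcases Nat.eq_zero_or_pos m with rfl | hm
  · simpa using Real.log_natCast_nonneg n
  · exact Real.log_le_log (by exact_mod_cast hm) (by exact_mod_cast h)

theorem AlgWT.mono (h : ∀ d ε, N d ε ≤ N' d ε) (hw : AlgWT N') : AlgWT N := by
  refine ⟨fun d ε hε => ne_top_of_le_ne_top (hw.1 d ε hε) (h d ε), ?_⟩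
  refine tendsto_of_tendsto_of_tendsto_of_le_of_le' tendsto_const_nhds hw.2 ?_ ?_
  · filter_upwards [mem_inf_of_right (mem_principal_self _)] with z hz
    have := inv_pos.2 hz.1
    have := Real.log_natCast_nonneg (N z.2 z.1).toNat
    positivity
  · filter_upwards [mem_inf_of_right (mem_principal_self _)] with z hz
    have := inv_pos.2 hz.1
    exact div_le_div_of_nonneg_right
      (log_natCast_mono (ENat.toNat_le_toNat (h _ _) (hw.1 _ _ hz))) (by positivity)

/-- With `η = 1` one has `ln k ≤ ln K + 2 ln n`, with `n` taken at `ε/2`. Halving `ε` at most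
doubles `ε⁻¹ + d`, so the new quotient is at most a null sequence plus four times the old quotient
at `(ε/2, d)`. -/
theorem AlmostEquivalent.algWT (h : AlmostEquivalent N N') (hw : AlgWT N) : AlgWT N' := by
  obtain ⟨K, hK, hk⟩ := h.exists_le 1 one_pos le_rfl
  have hfin : ∀ (d : ℕ+) (ε : ℝ), ε ∈ Ioo (0 : ℝ) 1 → ∃ n k : ℕ, N d (ε / 2) = n ∧ N' d ε = k ∧
      (k : ℝ) ≤ K * (n : ℝ) ^ 2 := by
    intro d ε hε
    have hε' := div_one_add_mem_Ioo one_pos hε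
    obtain ⟨n, hn⟩ := ENat.ne_top_iff_exists.1 (hw.1 d _ hε')
    obtain ⟨k, hkn, hkb⟩ := hk d ε hε.1 n hn.symm
    rw [one_add_one_eq_two] at hn hkb
    exact ⟨n, k, hn.symm, hkn, by exact_mod_cast hkb⟩
  refine ⟨fun d ε hε => ?_, ?_⟩
  · obtain ⟨n, k, -, hk', -⟩ := hfin d ε hε
    rw [hk']
    exact ENat.natCast_ne_top k
  set l := comap (fun z : ℝ × ℕ+ => z.1⁻¹ + ((z.2 : ℕ) : ℝ)) atTop ⊓
    𝓟 {z : ℝ × ℕ+ | z.1 ∈ Ioo (0 : ℝ) 1} with hl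
  have hIoo : ∀ᶠ z : ℝ × ℕ+ in l, z.1 ∈ Ioo (0 : ℝ) 1 := mem_inf_of_right (mem_principal_self _)
  have hz : Tendsto (fun z : ℝ × ℕ+ => z.1⁻¹ + ((z.2 : ℕ) : ℝ)) l atTop :=
    tendsto_comap.mono_left inf_le_left
  have hhalf : Tendsto (fun z : ℝ × ℕ+ => (z.1 / 2, z.2)) l l := by
    refine tendsto_inf.2 ⟨tendsto_comap_iff.2 ?_, tendsto_principal.2 ?_⟩
    · refine tendsto_atTop_mono' l ?_ hz
      filter_upwards [hIoo] with z hz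
      have := inv_pos.2 hz.1
      simp only [Function.comp_apply, inv_div]
      have h2 : 2 / z.1 = z.1⁻¹ + z.1⁻¹ := by ring
      linarith
    · filter_upwards [hIoo] with z hz
      constructor
      · exact half_pos hz.1
      · have := hz.2
        change z.1 / 2 < 1
        linarith
  have hup : Tendsto (fun z : ℝ × ℕ+ => Real.log K / (z.1⁻¹ + ((z.2 : ℕ) : ℝ)) +
      4 * (Real.log ((N z.2 (z.1 / 2)).toNat : ℝ) / ((z.1 / 2)⁻¹ + ((z.2 : ℕ) : ℝ)))) l (𝓝 0) := by
    have h1 := (tendsto_const_nhds (x := Real.log K)).div_atTop hz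
    have h2 := (hw.2.comp hhalf).const_mul 4
    simpa using h1.add h2
  refine tendsto_of_tendsto_of_tendsto_of_le_of_le' tendsto_const_nhds hup ?_ ?_
  · filter_upwards [hIoo] with z hz
    have := inv_pos.2 hz.1
    have := Real.log_natCast_nonneg (N' z.2 z.1).toNat
    positivity
  · filter_upwards [hIoo] with z hz
    obtain ⟨n, k, hn, hk', hkb⟩ := hfin z.2 z.1 hz
    have hi := inv_pos.2 hz.1
    have hd : (0 : ℝ) < ((z.2 : ℕ) : ℝ) := by exact_mod_cast z.2.pos
    rw [hn, hk', ENat.toNat_natCast, ENat.toNat_natCast]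
    have hn0 := Real.log_natCast_nonneg n
    have h1 : Real.log k ≤ Real.log K + 2 * Real.log n := by
      -- For `k = 0` the convention `log 0 = 0` applies; for `k > 0` the bound forces `n > 0`, so
      -- the logarithm of the product splits.
      rcases Nat.eq_zero_or_pos k with rfl | hk0
      · have := Real.log_nonneg hK
        simp only [Nat.cast_zero, Real.log_zero]
        positivity
      · have hk0' : (0 : ℝ) < k := by exact_mod_cast hk0
        have hn' : (n : ℝ) ≠ 0 := by
          intro h0
          rw [h0] at hkb
          norm_num at hkb
          omega
        refine (Real.log_le_log hk0' hkb).trans ?_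
        rw [Real.log_mul (by positivity) (by positivity), Real.log_pow]
        norm_num
    have h2 : (z.1 / 2)⁻¹ + ((z.2 : ℕ) : ℝ) ≤ 2 * (z.1⁻¹ + ((z.2 : ℕ) : ℝ)) := by
      rw [inv_div, div_eq_mul_inv]
      linarith
    have h3 : 2 * Real.log n / (z.1⁻¹ + ((z.2 : ℕ) : ℝ)) ≤
        4 * (Real.log n / ((z.1 / 2)⁻¹ + ((z.2 : ℕ) : ℝ))) := by
      have hi' : 0 < (z.1 / 2)⁻¹ := inv_pos.2 (half_pos hz.1)
      rw [← mul_div_assoc, div_le_div_iff₀ (by positivity) (by positivity)]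
      nlinarith
    calc _ ≤ (Real.log K + 2 * Real.log n) / (z.1⁻¹ + ((z.2 : ℕ) : ℝ)) := by gcongr
      _ = Real.log K / (z.1⁻¹ + ((z.2 : ℕ) : ℝ)) + 2 * Real.log n / (z.1⁻¹ + ((z.2 : ℕ) : ℝ)) :=
        add_div _ _ _
      _ ≤ _ := by gcongr

theorem ApproxProblem.almostEquivalent_infoComplexity {𝕜 : Type} [RCLike 𝕜]
    (APP : (d : ℕ+) → ApproxProblem 𝕜 (d : ℕ)) :
    AlmostEquivalent (fun d ε => (APP d).infoComplexity (APP d).allInfo ε)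
      (fun d ε => (APP d).infoComplexity (APP d).stdInfo ε) where
  le d ε := infoComplexity_mono (subset_univ _) ε
  exists_le η hη hη1 := by
    obtain ⟨C, hC, h⟩ := exists_infoComplexity_stdInfo_le hη hη1
    exact ⟨C, hC, fun d ε hε n hn => h (APP d) hε n hn⟩

end Tractability

end

theorem theorem2p5 {𝕜 : Type} [RCLike 𝕜] (APP : (d : ℕ+) → ApproxProblem 𝕜 (d : ℕ)) :
    (AlgSPT (fun d ε => (APP d).infoComplexity (APP d).allInfo ε) ↔
      AlgSPT (fun d ε => (APP d).infoComplexity (APP d).stdInfo ε)) ∧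
    (AlgPT (fun d ε => (APP d).infoComplexity (APP d).allInfo ε) ↔
      AlgPT (fun d ε => (APP d).infoComplexity (APP d).stdInfo ε)) ∧
    (AlgQPT (fun d ε => (APP d).infoComplexity (APP d).allInfo ε) ↔
      AlgQPT (fun d ε => (APP d).infoComplexity (APP d).stdInfo ε)) ∧
    (AlgWT (fun d ε => (APP d).infoComplexity (APP d).allInfo ε) ↔
      AlgWT (fun d ε => (APP d).infoComplexity (APP d).stdInfo ε)) ∧
    algSPTExponent (fun d ε => (APP d).infoComplexity (APP d).allInfo ε) =
      algSPTExponent (fun d ε => (APP d).infoComplexity (APP d).stdInfo ε) ∧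
    algQPTExponent (fun d ε => (APP d).infoComplexity (APP d).allInfo ε) =
      algQPTExponent (fun d ε => (APP d).infoComplexity (APP d).stdInfo ε) := by
  have h := ApproxProblem.almostEquivalent_infoComplexity APP
  exact ⟨⟨fun ⟨_, hp⟩ => ⟨_, h.algSPTWith hp one_pos le_rfl⟩, fun ⟨p, hp⟩ => ⟨p, hp.mono h.le⟩⟩,
    ⟨h.algPT, AlgPT.mono h.le⟩,
    ⟨fun ⟨_, hp⟩ => ⟨_, h.algQPTWith hp one_pos le_rfl⟩, fun ⟨p, hp⟩ => ⟨p, hp.mono h.le⟩⟩,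
    ⟨h.algWT, AlgWT.mono h.le⟩,
    iInf_exponent_eq (fun _ => AlgSPTWith.mono h.le) fun _ hp _ hη hη1 => h.algSPTWith hp hη hη1,
    iInf_exponent_eq (fun _ => AlgQPTWith.mono h.le) fun _ hp _ hη hη1 => h.algQPTWith hp hη hη1⟩
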